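/- Let $\mathsf V$ be the variety of all $\ell$-groups (respectively, of representable $\ell$-groups, i.e. subdirect products of totally ordered groups, or of Abelian $\ell$-groups), and let $G$ be a partially ordered group. Let $\eta\colon G\to F_{\mathsf V}(G)$ be the universal positive homomorphism to the $\ell$-group freely generated by $G$ in $\mathsf V$. A *right pre-order* on a partially ordered group $G$ is given by its positive cone: a proper submonoid $C\subsetneq G$ with $G^+\subseteq C$ and $G=C\cup C^{-1}$ (so $a\preceq_C b\iff ba^{-1}\in C$). Let $\Omega_C$ be the chain of classes $[a]$ of $G$ modulo $a\preceq_C b\preceq_C a$, and let $H_C$ be the $\ell$-subgroup of $\mathrm{Aut}(\Omega_C)$ (with product $f\cdot g$ = "$g$ after $f$" and pointwise lattice operations) generated by the maps $[b]\mapsto[ba]$, $a\in G$. Let $\mathcal P_{\mathsf V}(G)$ be the set of right pre-orders $C$ on $G$ with $H_C\in\mathsf V$, with the smallest topology in which the sets $\mathbb P(a)=\{C : a\in C,\ a^{-1}\notin C\}$, $a\in G$, are open. Its *minimal layer* is the subspace of its inclusion-minimal members. A *right order* is a right pre-order $C$ with $C\cap C^{-1}=\{e\}$, and an *order* is a right order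 whose cone is closed under conjugation; both sets carry the topology induced by the sets $\mathbb P(a)$. The group $\eta[G]$ is partially ordered by the restriction of the order of $F_{\mathsf V}(G)$. For $S$ a subset of an $\ell$-group $H$ let $S^\perp=\{x : |x|\wedge|y|=e \text{ for all } y\in S\}$; the sets $S^\perp$ are the polars of $H$, which form a Boolean algebra under inclusion with complement $T\mapsto T^\perp$, and the *principal polars* are the sets $x^{\perp\perp}=\{x\}^{\perp\perp}$, $x\in H$. **Theorem.** The minimal layer of $\mathcal P_{\mathsf V}(G)$ is a Stone space (compact, Hausdorff, totally disconnected). The set of principal polars of $F_{\mathsf V}(G)$ is a Boolean subalgebra of the algebra of polars of $F_{\mathsf V}(G)$, and it is the dual Boolean algebra of the minimal layer: it is isomorphic to the Boolean algebra of clopen subsets of the minimal layer, and the minimal layer is homeomorphic to its Stone dual, the space of its prime ideals with the topology generated by the sets of prime ideals that omit a given element. Moreover, $C\mapsto\eta[C]$ is a homeomorphism from the minimal layer onto the space of right orders on $\eta[G]$ if $\mathsf V$ is the variety of all $\ell$-groups, and onto the space of orders on $\eta[G]$ if $\mathsf V$ is the variety of representable or of Abelian $\ell$-groups. -/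

import Mathlib

universe u

namespace LGrp

/-! ### Lattice-ordered groups

A partially ordered group is a type with `Group`, `PartialOrder`, `MulLeftMono`, `MulRightMono`;
an `ℓ`-group is a type with `Group`, `Lattice`, `MulLeftMono`, `MulRightMono`. -/

/-- A class of `ℓ`-groups. -/
def LGroupClass : Type (u + 1) :=
  ∀ (H : Type u) [Group H] [Lattice H] [MulLeftMono H] [MulRightMono H], Prop

/-- A group homomorphism between `ℓ`-groups is an `ℓ`-homomorphism if it preserves `⊔` and `⊓`. -/
def IsLHom {H K : Type*} [Group H] [Lattice H] [Group K] [Lattice K] (f : H →* K) : Prop :=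
  (∀ a b, f (a ⊔ b) = f a ⊔ f b) ∧ ∀ a b, f (a ⊓ b) = f a ⊓ f b

/-- The variety of all `ℓ`-groups. -/
def allLGroups : LGroupClass.{u} := fun _ _ _ _ _ => True

/-- The variety of Abelian `ℓ`-groups. -/
def abelianLGroups : LGroupClass.{u} := fun H _ _ _ _ => ∀ a b : H, a * b = b * a

/-- The variety of representable `ℓ`-groups: the subdirect products of totally ordered groups. -/
def representableLGroups : LGroupClass.{u} := fun H _ _ _ _ =>
  ∃ (ι : Type u) (L : ι → Type u) (_ : ∀ i, Group (L i)) (_ : ∀ i, LinearOrder (L i))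
    (_ : ∀ i, MulLeftMono (L i)) (_ : ∀ i, MulRightMono (L i)) (f : ∀ i, H →* L i),
    (∀ i, IsLHom (f i)) ∧ (∀ i, Function.Surjective (f i)) ∧
      ∀ x y : H, (∀ i, f i x = f i y) → x = y

/-! ### The `ℓ`-group generated by a subset -/

section Closure

variable {K : Type*} [Group K] [Lattice K]

/-- The `ℓ`-subgroup (sublattice subgroup) generated by `S`. -/
def lClosure (S : Set K) : Subgroup K :=
  sInf {L : Subgroup K | S ⊆ L ∧ (∀ a ∈ L, ∀ b ∈ L, a ⊔ b ∈ L) ∧ ∀ a ∈ L, ∀ b ∈ L, a ⊓ b ∈ L}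

theorem lClosure_sup (S : Set K) {a b : K} (ha : a ∈ lClosure S) (hb : b ∈ lClosure S) :
    a ⊔ b ∈ lClosure S := by
  simp only [lClosure, Subgroup.mem_sInf] at ha hb ⊢
  exact fun L hL => hL.2.1 _ (ha L hL) _ (hb L hL)

theorem lClosure_inf (S : Set K) {a b : K} (ha : a ∈ lClosure S) (hb : b ∈ lClosure S) :
    a ⊓ b ∈ lClosure S := by
  simp only [lClosure, Subgroup.mem_sInf] at ha hb ⊢
  exact fun L hL => hL.2.2 _ (ha L hL) _ (hb L hL)

instance lClosureLattice (S : Set K) : Lattice (lClosure S) :=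
  Subtype.lattice (fun _ _ ha hb => lClosure_sup S ha hb) (fun _ _ ha hb => lClosure_inf S ha hb)

end Closure

section SubgroupMono

variable {K : Type*} [Group K] [PartialOrder K]

instance subgroupMulLeftMono [MulLeftMono K] (L : Subgroup K) : MulLeftMono L :=
  ⟨fun c _ _ h => mul_le_mul_right (α := K) h (c : K)⟩

instance subgroupMulRightMono [MulRightMono K] (L : Subgroup K) : MulRightMono L :=
  ⟨fun c _ _ h => mul_le_mul_left (α := K) h (c : K)⟩

instance lClosureMulLeftMono {K : Type*} [Group K] [Lattice K] [MulLeftMono K] (S : Set K) :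
    MulLeftMono (lClosure S) :=
  ⟨fun c _ _ h => mul_le_mul_right (α := K) h (c : K)⟩

instance lClosureMulRightMono {K : Type*} [Group K] [Lattice K] [MulRightMono K] (S : Set K) :
    MulRightMono (lClosure S) :=
  ⟨fun c _ _ h => mul_le_mul_left (α := K) h (c : K)⟩

end SubgroupMono

/-! ### The `ℓ`-group of order automorphisms of a chain -/

/-- The `ℓ`-group of order-preserving bijections of a chain `Ω`, where `f * g` is
"`g` after `f`" and the lattice operations are pointwise. -/
def Aut (Ω : Type*) [LinearOrder Ω] : Type _ := Ω ≃o Ω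

namespace Aut

variable {Ω : Type*} [LinearOrder Ω]

instance : FunLike (Aut Ω) Ω Ω where
  coe f := RelIso.toEquiv f
  coe_injective f g h := by
    apply RelIso.ext
    exact fun x => congrFun h x

@[ext] theorem ext {f g : Aut Ω} (h : ∀ x, f x = g x) : f = g := DFunLike.ext _ _ h

instance : Group (Aut Ω) where
  mul f g := OrderIso.trans (f : Ω ≃o Ω) (g : Ω ≃o Ω)
  one := OrderIso.refl Ω
  inv f := OrderIso.symm (f : Ω ≃o Ω)
  mul_assoc _ _ _ := rfl
  one_mul _ := rfl
  mul_one _ := rfl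
  inv_mul_cancel f := OrderIso.symm_trans_self (f : Ω ≃o Ω)

@[simp] theorem mul_apply (f g : Aut Ω) (x : Ω) : (f * g) x = g (f x) := rfl
@[simp] theorem one_apply (x : Ω) : (1 : Aut Ω) x = x := rfl

theorem le_iff_le (f : Aut Ω) {x y : Ω} : f x ≤ f y ↔ x ≤ y := OrderIso.le_iff_le (f : Ω ≃o Ω)
theorem mono (f : Aut Ω) : Monotone f := fun _ _ h => (le_iff_le f).2 h

@[simp] theorem apply_inv (f : Aut Ω) (x : Ω) : f (f⁻¹ x) = x :=
  OrderIso.apply_symm_apply (f : Ω ≃o Ω) x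
@[simp] theorem inv_apply (f : Aut Ω) (x : Ω) : f⁻¹ (f x) = x :=
  OrderIso.symm_apply_apply (f : Ω ≃o Ω) x

instance : PartialOrder (Aut Ω) := PartialOrder.lift (fun f => (f : Ω → Ω)) DFunLike.coe_injective

theorem le_def {f g : Aut Ω} : f ≤ g ↔ ∀ x, f x ≤ g x := Iff.rfl

/-- The pointwise supremum; its inverse is the pointwise infimum of the inverses. -/
def sup (f g : Aut Ω) : Aut Ω := StrictMono.orderIsoOfRightInverse (fun x => max (f x) (g x))
    (fun x y h => max_lt_max (((mono f).strictMono_of_injective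
      (RelIso.toEquiv f).injective) h) (((mono g).strictMono_of_injective
      (RelIso.toEquiv g).injective) h))
    (fun y => min (f⁻¹ y) (g⁻¹ y))
    (fun y => by
      rcases le_total (f⁻¹ y) (g⁻¹ y) with h | h
      · have := mono g h
        simp only [apply_inv] at this
        simp [min_eq_left h, this]
      · have := mono f h
        simp only [apply_inv] at this
        simp [min_eq_right h, this])

/-- The pointwise infimum; its inverse is the pointwise supremum of the inverses. -/
def inf (f g : Aut Ω) : Aut Ω := StrictMono.orderIsoOfRightInverse (fun x => min (f x) (g x))
    (fun x y h => min_lt_min (((mono f).strictMono_of_injective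
      (RelIso.toEquiv f).injective) h) (((mono g).strictMono_of_injective
      (RelIso.toEquiv g).injective) h))
    (fun y => max (f⁻¹ y) (g⁻¹ y))
    (fun y => by
      rcases le_total (f⁻¹ y) (g⁻¹ y) with h | h
      · have := mono f h
        simp only [apply_inv] at this
        simp [max_eq_right h, this]
      · have := mono g h
        simp only [apply_inv] at this
        simp [max_eq_left h, this])

instance : Lattice (Aut Ω) where
  sup := sup
  inf := inf
  le_sup_left _ _ _ := le_max_left _ _
  le_sup_right _ _ _ := le_max_right _ _
  sup_le _ _ _ h k x := max_le (h x) (k x)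
  inf_le_left _ _ _ := min_le_left _ _
  inf_le_right _ _ _ := min_le_right _ _
  le_inf _ _ _ h k x := le_min (h x) (k x)

@[simp] theorem sup_apply (f g : Aut Ω) (x : Ω) : (f ⊔ g) x = max (f x) (g x) := rfl
@[simp] theorem inf_apply (f g : Aut Ω) (x : Ω) : (f ⊓ g) x = min (f x) (g x) := rfl

instance : MulLeftMono (Aut Ω) := ⟨fun c _ _ h x => h (c x)⟩
instance : MulRightMono (Aut Ω) := ⟨fun c _ _ h x => mono c (h x)⟩

end Aut

/-! ### Right pre-orders on a partially ordered group -/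

/-- A right pre-order on the partially ordered group `G`, given by its positive cone: a proper
submonoid `C` of `G` with `G⁺ ⊆ C` and `G = C ∪ C⁻¹`. The pre-order is `a ≼ b ↔ b * a⁻¹ ∈ C`. -/
structure PreCone (G : Type*) [Group G] [PartialOrder G] extends Submonoid G where
  pos_mem' : ∀ a : G, 1 ≤ a → a ∈ carrier
  total' : ∀ a : G, a ∈ carrier ∨ a⁻¹ ∈ carrier
  proper' : ∃ a : G, a ∉ carrier

section PreCone

variable {G : Type u} [Group G] [PartialOrder G]

instance : SetLike (PreCone G) G where
  coe C := C.carrier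
  coe_injective C D h := by
    obtain ⟨⟨⟨_, _⟩, _⟩, _, _, _⟩ := C
    obtain ⟨⟨⟨_, _⟩, _⟩, _, _, _⟩ := D
    congr

/-- Pre-cones are ordered by inclusion. -/
instance : PartialOrder (PreCone G) := PartialOrder.lift (fun C => (C : Set G)) SetLike.coe_injective

/-- The set `ℙ(a)` of right pre-orders in which `a` is strictly positive. -/
def PreCone.P (a : G) : Set (PreCone G) := {C | a ∈ C ∧ a⁻¹ ∉ C}

/-- The smallest topology in which all the sets `ℙ(a)` are open. Sets of right pre-orders
carry the subspace topology; it is generated by the traces of the sets `ℙ(a)`. -/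
instance : TopologicalSpace (PreCone G) :=
  TopologicalSpace.generateFrom (Set.range PreCone.P)

namespace PreCone

variable (C : PreCone G)

/-- The set `G` equipped with the right pre-order `C`. -/
def Carrier (_ : PreCone G) : Type u := G

/-- The underlying element of `G`. -/
def toG {C : PreCone G} (a : C.Carrier) : G := a

instance : Preorder C.Carrier where
  le a b := toG b * (toG a)⁻¹ ∈ C
  le_refl a := by
    rw [mul_inv_cancel]
    exact C.one_mem'
  le_trans a b c h k := by
    have := C.mul_mem' k h
    rwa [mul_assoc, inv_mul_cancel_left] at this

instance : Std.Total (α := C.Carrier) (· ≤ ·) where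
  total a b := by
    rcases C.total' (toG b * (toG a)⁻¹) with h | h
    · exact Or.inl h
    · rw [mul_inv_rev, inv_inv] at h
      exact Or.inr h

/-- The chain `Ω_C` of equivalence classes of `G` modulo `a ≼ b ≼ a`. -/
def Omega : Type u := Antisymmetrization C.Carrier (· ≤ ·)

/-- The class `[a]` in `Ω_C`. -/
def cls (a : G) : C.Omega := toAntisymmetrization (α := C.Carrier) (· ≤ ·) a

open Classical in
noncomputable instance : LinearOrder C.Omega :=
  inferInstanceAs (LinearOrder (Antisymmetrization C.Carrier (· ≤ ·)))

theorem cls_le_cls {a b : G} : C.cls a ≤ C.cls b ↔ b * a⁻¹ ∈ C := Iff.rfl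

theorem cls_eq_cls {a b : G} : C.cls a = C.cls b ↔ b * a⁻¹ ∈ C ∧ a * b⁻¹ ∈ C := by
  rw [le_antisymm_iff, cls_le_cls, cls_le_cls]

theorem cls_surjective : Function.Surjective C.cls := fun x => Quotient.inductionOn' x fun a => ⟨a, rfl⟩

/-- The map `[b] ↦ [b * a]` on `Ω_C`. -/
def transl (a : G) : C.Omega → C.Omega :=
  Quotient.map' (fun b : C.Carrier => (toG b * a : G)) (by
    intro b c h
    have h' := C.cls_eq_cls.1 (Quotient.sound' h : C.cls b = C.cls c)
    refine Quotient.exact' (C.cls_eq_cls.2 ?_ : C.cls (toG b * a) = C.cls (toG c * a))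
    have key : ∀ x y : G, x * a * (y * a)⁻¹ = x * y⁻¹ := fun x y => by group
    rwa [key, key])

@[simp] theorem transl_cls (a b : G) : C.transl a (C.cls b) = C.cls (b * a) := rfl

/-- The right regular representation `R_C : G → Aut Ω_C`, given by `R_C(a)([b]) = [b * a]`. -/
noncomputable def R : G →* Aut C.Omega where
  toFun a :=
    { toFun := C.transl a
      invFun := C.transl a⁻¹
      left_inv := fun x => by
        obtain ⟨b, rfl⟩ := C.cls_surjective x
        simp
      right_inv := fun x => by
        obtain ⟨b, rfl⟩ := C.cls_surjective x
        simp
      map_rel_iff' := fun {x y} => by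
        obtain ⟨b, rfl⟩ := C.cls_surjective x
        obtain ⟨c, rfl⟩ := C.cls_surjective y
        simp [cls_le_cls, mul_assoc] }
  map_one' := by
    ext x
    obtain ⟨b, rfl⟩ := C.cls_surjective x
    exact congrArg C.cls (mul_one b)
  map_mul' a b := by
    ext x
    obtain ⟨c, rfl⟩ := C.cls_surjective x
    exact congrArg C.cls (mul_assoc c a b).symm

@[simp] theorem R_apply_cls (a b : G) : C.R a (C.cls b) = C.cls (b * a) := rfl

/-- The `ℓ`-group `H_C`: the `ℓ`-subgroup of `Aut Ω_C` generated by the image of `R_C`. -/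
abbrev H : Type u := lClosure (Set.range C.R)

end PreCone

/-- The space of `V`-right pre-orders on `G`: the right pre-orders `C` with `H_C` in `V`. -/
def rightPreorders (V : LGroupClass.{u}) (G : Type u) [Group G] [PartialOrder G] :
    Set (PreCone G) :=
  {C | V C.H}

/-- The minimal layer: the inclusion-minimal elements of the set of `V`-right pre-orders on `G`. -/
def minimalLayer (V : LGroupClass.{u}) (G : Type u) [Group G] [PartialOrder G] :
    Set (PreCone G) :=
  {C | Minimal (· ∈ rightPreorders V G) C}

/-- The space of right orders on `G`: the right pre-orders `C` with `C ∩ C⁻¹ = {1}`, that is, the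
right-invariant proper total orders extending the order of `G`. -/
def rightOrders (G : Type u) [Group G] [PartialOrder G] : Set (PreCone G) :=
  {C | ∀ a : G, a ∈ C → a⁻¹ ∈ C → a = 1}

/-- The space of orders on `G`: the right orders that are also left invariant, that is, whose
positive cone is closed under conjugation. -/
def orders (G : Type u) [Group G] [PartialOrder G] : Set (PreCone G) :=
  {C | C ∈ rightOrders G ∧ ∀ a ∈ C, ∀ b : G, b * a * b⁻¹ ∈ C}

end PreCone

/-! ### The free `ℓ`-group over a partially ordered group -/

/-- `ℓ`-group terms over `G`. -/
inductive Term (G : Type u) : Type u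
  | of : G → Term G
  | one : Term G
  | mul : Term G → Term G → Term G
  | inv : Term G → Term G
  | sup : Term G → Term G → Term G
  | inf : Term G → Term G → Term G

/-- The value of a term in an `ℓ`-group. -/
def Term.eval {G : Type u} {H : Type*} [Group H] [Lattice H] (p : G → H) : Term G → H
  | .of a => p a
  | .one => 1
  | .mul s t => s.eval p * t.eval p
  | .inv t => (t.eval p)⁻¹
  | .sup s t => s.eval p ⊔ t.eval p
  | .inf s t => s.eval p ⊓ t.eval p

section Free

variable (V : LGroupClass.{u}) (G : Type u) [Group G] [PartialOrder G]

/-- Two terms are identified if they have equal values under all positive homomorphisms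
from `G` to `ℓ`-groups in `V`. -/
def termSetoid : Setoid (Term G) where
  r s t := ∀ (H : Type u) [Group H] [Lattice H] [MulLeftMono H] [MulRightMono H], V H →
    ∀ p : G →* H, Monotone p → s.eval p = t.eval p
  iseqv :=
    { refl := fun _ _ _ _ _ _ _ _ _ => rfl
      symm := fun h H _ _ _ _ hV p hp => (h H hV p hp).symm
      trans := fun h k H _ _ _ _ hV p hp => (h H hV p hp).trans (k H hV p hp) }

/-- The `ℓ`-group `F_V(G)` freely generated by the partially ordered group `G` in `V`. -/
def Free : Type u := Quotient (termSetoid V G)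

namespace Free

variable {V G}

/-- The class of a term. -/
def mk (t : Term G) : Free V G := Quotient.mk (termSetoid V G) t

/-- The map `F_V(G) → H` induced by a positive homomorphism `p : G → H`. -/
def ev {H : Type u} [Group H] [Lattice H] [MulLeftMono H] [MulRightMono H] (hV : V H)
    (p : G →* H) (hp : Monotone p) : Free V G → H :=
  Quotient.lift (fun t => t.eval p) (fun _ _ h => h H hV p hp)

theorem ext {x y : Free V G}
    (h : ∀ (H : Type u) [Group H] [Lattice H] [MulLeftMono H] [MulRightMono H] (hV : V H)
      (p : G →* H) (hp : Monotone p), ev hV p hp x = ev hV p hp y) : x = y := by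
  induction x using Quotient.inductionOn
  induction y using Quotient.inductionOn
  exact Quotient.sound fun H _ _ _ _ hV p hp => h H hV p hp

instance : One (Free V G) := ⟨mk .one⟩
instance : Mul (Free V G) :=
  ⟨Quotient.map₂ Term.mul fun _ _ h _ _ k H _ _ _ _ hV p hp =>
    congrArg₂ (· * ·) (h H hV p hp) (k H hV p hp)⟩
instance : Inv (Free V G) :=
  ⟨Quotient.map Term.inv fun _ _ h H _ _ _ _ hV p hp => congrArg (·⁻¹) (h H hV p hp)⟩
/-- The join of `F_V(G)`. -/
def sup : Free V G → Free V G → Free V G :=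
  Quotient.map₂ Term.sup fun _ _ h _ _ k H _ _ _ _ hV p hp =>
    congrArg₂ (· ⊔ ·) (h H hV p hp) (k H hV p hp)

/-- The meet of `F_V(G)`. -/
def inf : Free V G → Free V G → Free V G :=
  Quotient.map₂ Term.inf fun _ _ h _ _ k H _ _ _ _ hV p hp =>
    congrArg₂ (· ⊓ ·) (h H hV p hp) (k H hV p hp)

section ev

variable {H : Type u} [Group H] [Lattice H] [MulLeftMono H] [MulRightMono H] (hV : V H)
    (p : G →* H) (hp : Monotone p)

@[simp] theorem ev_mk (t : Term G) : ev hV p hp (mk t) = t.eval p := rfl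
@[simp] theorem ev_one : ev hV p hp 1 = 1 := rfl
@[simp] theorem ev_mul (x y : Free V G) :
    ev hV p hp (x * y) = ev hV p hp x * ev hV p hp y := by
  induction x using Quotient.inductionOn
  induction y using Quotient.inductionOn
  rfl
@[simp] theorem ev_inv (x : Free V G) : ev hV p hp x⁻¹ = (ev hV p hp x)⁻¹ := by
  induction x using Quotient.inductionOn
  rfl
theorem ev_sup' (x y : Free V G) :
    ev hV p hp (sup x y) = ev hV p hp x ⊔ ev hV p hp y := by
  induction x using Quotient.inductionOn
  induction y using Quotient.inductionOn
  rfl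
theorem ev_inf' (x y : Free V G) :
    ev hV p hp (inf x y) = ev hV p hp x ⊓ ev hV p hp y := by
  induction x using Quotient.inductionOn
  induction y using Quotient.inductionOn
  rfl

end ev

instance : Group (Free V G) where
  mul_assoc x y z := ext fun H _ _ _ _ hV p hp => by simp [mul_assoc]
  one_mul x := ext fun H _ _ _ _ hV p hp => by simp
  mul_one x := ext fun H _ _ _ _ hV p hp => by simp
  inv_mul_cancel x := ext fun H _ _ _ _ hV p hp => by simp

/-- The order of `F_V(G)` is determined by its join. -/
theorem sup_eq_iff {x y : Free V G} : sup x y = y ↔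
    ∀ (H : Type u) [Group H] [Lattice H] [MulLeftMono H] [MulRightMono H] (hV : V H)
      (p : G →* H) (hp : Monotone p), ev hV p hp x ≤ ev hV p hp y := by
  constructor
  · intro h H _ _ _ _ hV p hp
    rw [← sup_eq_right, ← ev_sup', h]
  · intro h
    refine ext fun H _ _ _ _ hV p hp => ?_
    rw [ev_sup', sup_eq_right]
    exact h H hV p hp

instance : Lattice (Free V G) where
  le x y := sup x y = y
  le_refl x := sup_eq_iff.2 fun H _ _ _ _ hV p hp => le_rfl
  le_trans x y z h k := sup_eq_iff.2 fun H _ _ _ _ hV p hp =>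
    (sup_eq_iff.1 h H hV p hp).trans (sup_eq_iff.1 k H hV p hp)
  le_antisymm x y h k := ext fun H _ _ _ _ hV p hp =>
    (sup_eq_iff.1 h H hV p hp).antisymm (sup_eq_iff.1 k H hV p hp)
  sup := sup
  le_sup_left x y := sup_eq_iff.2 fun H _ _ _ _ hV p hp => by
    rw [ev_sup']; exact le_sup_left
  le_sup_right x y := sup_eq_iff.2 fun H _ _ _ _ hV p hp => by
    rw [ev_sup']; exact le_sup_right
  sup_le x y z h k := sup_eq_iff.2 fun H _ _ _ _ hV p hp => by
    rw [ev_sup']; exact sup_le (sup_eq_iff.1 h H hV p hp) (sup_eq_iff.1 k H hV p hp)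
  inf := inf
  inf_le_left x y := sup_eq_iff.2 fun H _ _ _ _ hV p hp => by
    rw [ev_inf']; exact inf_le_left
  inf_le_right x y := sup_eq_iff.2 fun H _ _ _ _ hV p hp => by
    rw [ev_inf']; exact inf_le_right
  le_inf x y z h k := sup_eq_iff.2 fun H _ _ _ _ hV p hp => by
    rw [ev_inf']; exact le_inf (sup_eq_iff.1 h H hV p hp) (sup_eq_iff.1 k H hV p hp)

@[simp] theorem ev_sup {H : Type u} [Group H] [Lattice H] [MulLeftMono H] [MulRightMono H]
    (hV : V H) (p : G →* H) (hp : Monotone p) (x y : Free V G) :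
    ev hV p hp (x ⊔ y) = ev hV p hp x ⊔ ev hV p hp y := ev_sup' hV p hp x y

@[simp] theorem ev_inf {H : Type u} [Group H] [Lattice H] [MulLeftMono H] [MulRightMono H]
    (hV : V H) (p : G →* H) (hp : Monotone p) (x y : Free V G) :
    ev hV p hp (x ⊓ y) = ev hV p hp x ⊓ ev hV p hp y := ev_inf' hV p hp x y

theorem le_iff_ev {x y : Free V G} : x ≤ y ↔
    ∀ (H : Type u) [Group H] [Lattice H] [MulLeftMono H] [MulRightMono H] (hV : V H)
      (p : G →* H) (hp : Monotone p), ev hV p hp x ≤ ev hV p hp y := sup_eq_iff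

instance : MulLeftMono (Free V G) := ⟨fun c x y h => by
  rw [le_iff_ev] at h ⊢
  intro H _ _ _ _ hV p hp
  simp only [ev_mul]
  exact mul_le_mul_right (h H hV p hp) _⟩

instance : MulRightMono (Free V G) := ⟨fun c x y h => by
  rw [le_iff_ev] at h
  refine le_iff_ev.2 fun H _ _ _ _ hV p hp => ?_
  change ev hV p hp (x * c) ≤ ev hV p hp (y * c)
  simp only [ev_mul]
  exact mul_le_mul_left (h H hV p hp) _⟩

end Free

variable {G}

/-- The universal map `η : G → F_V(G)`. -/
def eta : G →* Free V G where
  toFun a := Free.mk (.of a)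
  map_one' := Free.ext fun H _ _ _ _ hV p hp => by simp [Term.eval]
  map_mul' a b := Free.ext fun H _ _ _ _ hV p hp => by simp [Term.eval]

theorem eta_monotone : Monotone (eta V : G → Free V G) := fun _ _ h =>
  Free.le_iff_ev.2 fun _ _ _ _ _ _ _ hp => hp h

/-- The universal property of `η`. -/
theorem eta_universal {H : Type u} [Group H] [Lattice H] [MulLeftMono H] [MulRightMono H]
    (hV : V H) (p : G →* H) (hp : Monotone p) :
    ∃! h : Free V G →* H, IsLHom h ∧ ∀ a, h (eta V a) = p a := by
  refine ⟨⟨⟨Free.ev hV p hp, Free.ev_one hV p hp⟩, Free.ev_mul hV p hp⟩,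
    ⟨⟨Free.ev_sup hV p hp, Free.ev_inf hV p hp⟩, fun _ => rfl⟩, ?_⟩
  rintro k ⟨⟨hs, hi⟩, ha⟩
  ext x
  change k x = Free.ev hV p hp x
  induction x using Quotient.inductionOn with | _ t
  change k (Free.mk t) = Free.ev hV p hp (Free.mk t)
  induction t with
  | of a => exact ha a
  | one => exact map_one k
  | mul s t h1 h2 => exact (map_mul k (Free.mk s) (Free.mk t)).trans (congrArg₂ (· * ·) h1 h2)
  | inv t h1 => exact (map_inv k (Free.mk t)).trans (congrArg (·⁻¹) h1)
  | sup s t h1 h2 => exact (hs (Free.mk s) (Free.mk t)).trans (congrArg₂ (· ⊔ ·) h1 h2)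
  | inf s t h1 h2 => exact (hi (Free.mk s) (Free.mk t)).trans (congrArg₂ (· ⊓ ·) h1 h2)

/-- `F_V(G)` lies in `V` for each of the three varieties. -/
theorem free_all_mem : allLGroups (Free allLGroups G) := trivial

theorem free_abelian_mem : abelianLGroups (Free abelianLGroups G) := fun x y =>
  Free.ext fun H _ _ _ _ hV p hp => by
    rw [Free.ev_mul, Free.ev_mul]
    exact hV _ _

theorem free_representable_mem : representableLGroups (Free representableLGroups G) := by
  classical
  have key : ∀ z : {z : Free representableLGroups G × Free representableLGroups G // z.1 ≠ z.2},
      ∃ (L : Type u) (_ : Group L) (_ : LinearOrder L) (_ : MulLeftMono L) (_ : MulRightMono L)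
        (f : Free representableLGroups G →* L),
        IsLHom f ∧ Function.Surjective f ∧ f z.1.1 ≠ f z.1.2 := by
    rintro ⟨⟨x, y⟩, hxy⟩
    by_contra! hcon
    refine hxy (Free.ext fun H _ _ _ _ hV p hp => ?_)
    obtain ⟨ι, L, _, _, _, _, f, hf, -, hinj⟩ := id hV
    refine hinj _ _ fun i => ?_
    let g : Free representableLGroups G →* L i :=
      (f i).comp ⟨⟨Free.ev hV p hp, Free.ev_one hV p hp⟩, Free.ev_mul hV p hp⟩
    have hg : IsLHom g :=
      ⟨fun a b => (congrArg (f i) (Free.ev_sup hV p hp a b)).trans ((hf i).1 _ _),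
        fun a b => (congrArg (f i) (Free.ev_inf hV p hp a b)).trans ((hf i).2 _ _)⟩
    have hres := hcon g.range inferInstance inferInstance inferInstance inferInstance
      g.rangeRestrict ⟨fun a b => ?_, fun a b => ?_⟩ g.rangeRestrict_surjective
    · exact congrArg Subtype.val hres
    · apply Subtype.ext
      rcases le_total (g.rangeRestrict a) (g.rangeRestrict b) with hab | hab
      · rw [sup_eq_right.2 hab]
        exact (hg.1 a b).trans (sup_eq_right.2 hab)
      · rw [sup_eq_left.2 hab]
        exact (hg.1 a b).trans (sup_eq_left.2 hab)
    · apply Subtype.ext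
      rcases le_total (g.rangeRestrict a) (g.rangeRestrict b) with hab | hab
      · rw [inf_eq_left.2 hab]
        exact (hg.2 a b).trans (inf_eq_left.2 hab)
      · rw [inf_eq_right.2 hab]
        exact (hg.2 a b).trans (inf_eq_right.2 hab)
  choose L i1 i2 i3 i4 f hf hs hne using key
  refine ⟨_, L, i1, i2, i3, i4, f, hf, hs, fun x y h => ?_⟩
  by_contra hxy
  exact hne ⟨(x, y), hxy⟩ (h ⟨(x, y), hxy⟩)

end Free

/-! ### Polars -/

section Polar

variable {H : Type*} [Group H] [Lattice H]

/-- `S^⊥`, the set of elements orthogonal to all elements of `S`. -/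
def polar (S : Set H) : Set H := {x | ∀ y ∈ S, |x|ₘ ⊓ |y|ₘ = 1}

variable (H) in
/-- The set of polars of `H`. -/
def polars : Set (Set H) := {T | ∃ S : Set H, T = polar S}

variable (H) in
/-- The set of principal polars `x^⊥⊥` of `H`, ordered by inclusion. -/
def principalPolars : Set (Set H) := {T | ∃ x : H, T = polar (polar {x})}

/-- `P` is a Boolean subalgebra of the Boolean algebra of polars of `H`, in which the order is
inclusion, the meet is intersection, the join is `(S ∪ T)^⊥⊥` and the complement is `T^⊥`. -/
structure IsBooleanSubalgebraOfPolars (P : Set (Set H)) : Prop where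
  subset : P ⊆ polars H
  top_mem : Set.univ ∈ P
  bot_mem : {1} ∈ P
  inf_mem : ∀ S ∈ P, ∀ T ∈ P, S ∩ T ∈ P
  sup_mem : ∀ S ∈ P, ∀ T ∈ P, polar (polar (S ∪ T)) ∈ P
  compl_mem : ∀ T ∈ P, polar T ∈ P

end Polar

/-! ### Stone duality -/

/-- The Stone dual `X(D)` of a lattice `D`: the space of its prime ideals. -/
def StoneDual (D : Type*) [Preorder D] : Type _ := {I : Order.Ideal D // I.IsPrime}

/-- The Stone topology has the sets of the prime ideals that omit a given `a : D` as a subbase. -/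
instance (D : Type*) [Preorder D] : TopologicalSpace (StoneDual D) :=
  TopologicalSpace.generateFrom (Set.range fun a : D => {I | a ∉ I.1})

/-- A Stone space: a compact Hausdorff totally disconnected space. -/
def IsStoneSpace (X : Type*) [TopologicalSpace X] : Prop :=
  CompactSpace X ∧ T2Space X ∧ TotallyDisconnectedSpace X

end LGrp

open LGrp

/-! The group `F_V(G)` acts on each chain `Ω_C`, and the support of `x ∈ F_V(G)` is the set of those
`C` in the minimal layer for which `x` moves the class `[1]`. The minimal layer consists of the
right pre-orders `C` with `C ∩ C⁻¹ = ker η` that are, for representable and Abelian `ℓ`-groups, in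
addition invariant under conjugation. Ultralimits of such right pre-orders are again of this kind,
so their space is compact. Whether a term fixes `[1]` is decided by finitely many memberships in
`C`, so supports are clopen, and by compactness each clopen set is a support. Orthogonality in
`F_V(G)` is disjointness of supports, since there are enough right pre-orders in the minimal layer
for `x = 1` to be the only element of empty support. Hence principal polars correspond to clopen
sets, and the rest is Stone duality.

A right pre-order detecting a given `x ≠ 1` of an `ℓ`-group is `{h | h⁻ ∉ U}`, where `U ∋ |x|` is a
maximal set of strictly positive elements that is closed under meets. -/

namespace LGrp

namespace PreCone

section Basic

variable {G : Type*} [Group G] [PartialOrder G]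

section

variable (C : PreCone G)

theorem one_mem : (1 : G) ∈ C := C.one_mem'

theorem mul_mem {a b : G} (ha : a ∈ C) (hb : b ∈ C) : a * b ∈ C := C.mul_mem' ha hb

theorem total (a : G) : a ∈ C ∨ a⁻¹ ∈ C := C.total' a

theorem mem_of_one_le {a : G} (ha : 1 ≤ a) : a ∈ C := C.pos_mem' a ha

theorem inv_mem_of_notMem {a : G} (ha : a ∉ C) : a⁻¹ ∈ C := (C.total a).resolve_left ha

@[ext] theorem ext {C D : PreCone G} (h : ∀ a, a ∈ C ↔ a ∈ D) : C = D := SetLike.ext h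

/-- The group `C ∩ C⁻¹` of the elements that are equivalent to `1` in the right pre-order `C`. -/
abbrev core : Subgroup G := C.toSubmonoid.mulSupport

theorem mem_core {a : G} : a ∈ C.core ↔ a ∈ C ∧ a⁻¹ ∈ C := Iff.rfl

theorem core_mono {C D : PreCone G} (h : C ≤ D) : C.core ≤ D.core :=
  fun _ ha => ⟨h ha.1, h ha.2⟩

/-- The right pre-order `C` is invariant under conjugation by the elements of `S`. -/
def IsInvariant (S : Subgroup G) : Prop := ∀ a ∈ C, ∀ b ∈ S, b * a * b⁻¹ ∈ C

theorem isInvariant_bot : C.IsInvariant ⊥ := by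
  rintro a ha b rfl
  simpa using ha

end

/-- The inverse image of a pre-cone under a positive homomorphism. -/
def comap {H : Type*} [Group H] [PartialOrder H] (p : G →* H) (hp : Monotone p) (D : PreCone H)
    (hD : ∃ a, p a ∉ D) : PreCone G where
  __ := D.toSubmonoid.comap p
  pos_mem' a ha := D.mem_of_one_le (by simpa using hp ha)
  total' a := (D.total (p a)).imp_right fun h => by rwa [← map_inv] at h
  proper' := hD

@[simp] theorem mem_comap {H : Type*} [Group H] [PartialOrder H] {p : G →* H} {hp : Monotone p}
    {D : PreCone H} {hD : ∃ a, p a ∉ D} {a : G} : a ∈ comap p hp D hD ↔ p a ∈ D := Iff.rfl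

/-- The limit of a family of submonoids along an ultrafilter. -/
def ultralimit {ι : Type*} (U : Ultrafilter ι) (M : ι → Submonoid G)
    (hpos : ∀ a, 1 ≤ a → ∀ᶠ i in U, a ∈ M i) (htotal : ∀ a, ∀ᶠ i in U, a ∈ M i ∨ a⁻¹ ∈ M i)
    (hproper : ∃ a, ∀ᶠ i in U, a ∉ M i) : PreCone G where
  carrier := {a | ∀ᶠ i in U, a ∈ M i}
  one_mem' := .of_forall fun i => (M i).one_mem
  mul_mem' ha hb := (ha.and hb).mono fun i h => (M i).mul_mem h.1 h.2
  pos_mem' := hpos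
  total' a := Ultrafilter.eventually_or.1 (htotal a)
  proper' := hproper.imp fun _ ha => Ultrafilter.eventually_not.1 ha

/-- The positive cone of a nontrivial totally ordered group. -/
def oneLE (L : Type*) [Group L] [LinearOrder L] [MulLeftMono L] [Nontrivial L] : PreCone L where
  __ := Submonoid.oneLE L
  pos_mem' _ ha := ha
  total' a := (le_total 1 a).imp_right one_le_inv'.2
  proper' := by
    obtain ⟨a, ha⟩ := exists_ne (1 : L)
    exact ha.lt_or_gt.elim (fun h => ⟨a, h.not_ge⟩) fun h => ⟨a⁻¹, (inv_lt_one'.2 h).not_ge⟩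

end Basic

variable {G : Type u} [Group G] [PartialOrder G] (C : PreCone G)

theorem cls_one_le {a : G} : C.cls 1 ≤ C.cls a ↔ a ∈ C := by simp [cls_le_cls]

theorem cls_le_one {a : G} : C.cls a ≤ C.cls 1 ↔ a⁻¹ ∈ C := by simp [cls_le_cls]

theorem cls_eq_cls_iff_mem_core {a b : G} : C.cls a = C.cls b ↔ b * a⁻¹ ∈ C.core := by
  rw [cls_eq_cls, mem_core, mul_inv_rev, inv_inv]

theorem cls_eq_one {a : G} : C.cls a = C.cls 1 ↔ a ∈ C.core := by
  rw [eq_comm, cls_eq_cls_iff_mem_core, inv_one, mul_one]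

variable {H : Type u} [Group H] [PartialOrder H] (D : PreCone H)

/-- The map `[a] ↦ [p a]` of chains induced by a homomorphism that preserves the cones. -/
def omegaMap (p : G →* H) (h : ∀ a ∈ C, p a ∈ D) : C.Omega → D.Omega :=
  Quotient.map' (fun b : C.Carrier => (p (toG b) : H)) fun b c hbc =>
    ⟨show p (toG c) * (p (toG b))⁻¹ ∈ D by simpa using h _ hbc.1,
      show p (toG b) * (p (toG c))⁻¹ ∈ D by simpa using h _ hbc.2⟩

@[simp] theorem omegaMap_cls (p : G →* H) (h : ∀ a ∈ C, p a ∈ D) (a : G) :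
    C.omegaMap D p h (C.cls a) = D.cls (p a) := rfl

theorem omegaMap_monotone (p : G →* H) (h : ∀ a ∈ C, p a ∈ D) : Monotone (C.omegaMap D p h) := by
  intro x y hxy
  obtain ⟨a, rfl⟩ := C.cls_surjective x
  obtain ⟨b, rfl⟩ := C.cls_surjective y
  rw [cls_le_cls] at hxy
  simpa [cls_le_cls] using h _ hxy

end PreCone

theorem IsLHom.of_map_sup {H K : Type*} [Group H] [Lattice H] [MulLeftMono H] [MulRightMono H]
    [Group K] [Lattice K] [MulLeftMono K] [MulRightMono K] {f : H →* K}
    (hf : ∀ a b, f (a ⊔ b) = f a ⊔ f b) : IsLHom f := by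
  refine ⟨hf, fun a b => inv_injective ?_⟩
  rw [← map_inv, inv_inf, hf, inv_inf, map_inv, map_inv]

theorem IsLHom.map_mabs {H K : Type*} [Group H] [Lattice H] [Group K] [Lattice K] {f : H →* K}
    (hf : IsLHom f) (x : H) : f |x|ₘ = |f x|ₘ := by
  rw [mabs, hf.1, map_inv, mabs]

theorem IsLHom.monotone {H K : Type*} [Group H] [Lattice H] [Group K] [Lattice K] {f : H →* K}
    (hf : IsLHom f) : Monotone f := fun a b hab => by
  rw [← sup_eq_right, ← hf.1, sup_eq_right.2 hab]

theorem eq_one_of_mabs_eq_one {H : Type*} [Group H] [Lattice H] [MulLeftMono H] {x : H}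
    (hx : |x|ₘ = 1) : x = 1 :=
  le_antisymm (hx ▸ le_mabs_self x) (inv_le_one'.1 (hx ▸ inv_le_mabs x))

namespace Aut

variable {Ω : Type*} [LinearOrder Ω]

theorem injective (f : Aut Ω) : Function.Injective f := fun x y h => by
  simpa using congrArg (f⁻¹ : Aut Ω) h

theorem inv_apply_eq {f : Aut Ω} {x y : Ω} : f⁻¹ x = y ↔ x = f y :=
  ⟨fun h => by rw [← h, apply_inv], fun h => by rw [h, inv_apply]⟩

theorem le_mabs_apply (f : Aut Ω) (x : Ω) : x ≤ |f|ₘ x := one_le_mabs f x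

theorem mabs_apply_eq {f : Aut Ω} {x : Ω} : |f|ₘ x = x ↔ f x = x := by
  constructor
  · intro h
    refine le_antisymm ((le_mabs_self f x).trans h.le) ?_
    have := f.mono ((inv_le_mabs f x).trans h.le)
    rwa [apply_inv] at this
  · intro h
    rw [mabs, sup_apply, h, inv_apply_eq.2 h.symm, max_self]

theorem mabs_inf_mabs_apply_eq {f g : Aut Ω} {x : Ω} :
    (|f|ₘ ⊓ |g|ₘ) x = x ↔ f x = x ∨ g x = x := by
  rw [inf_apply, ← mabs_apply_eq (f := f), ← mabs_apply_eq (f := g)]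
  rcases le_total (|f|ₘ x) (|g|ₘ x) with h | h
  · rw [min_eq_left h, or_iff_left_of_imp]
    exact fun hg => le_antisymm (h.trans hg.le) (le_mabs_apply f x)
  · rw [min_eq_right h, or_iff_right_of_imp]
    exact fun hf => le_antisymm (h.trans hf.le) (le_mabs_apply g x)

theorem mabs_sup_mabs_apply_eq {f g : Aut Ω} {x : Ω} :
    (|f|ₘ ⊔ |g|ₘ) x = x ↔ f x = x ∧ g x = x := by
  rw [sup_apply, ← mabs_apply_eq (f := f), ← mabs_apply_eq (f := g)]
  have hf := le_mabs_apply f x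
  have hg := le_mabs_apply g x
  constructor
  · exact fun h => ⟨((le_max_left _ _).trans h.le).antisymm hf,
      ((le_max_right _ _).trans h.le).antisymm hg⟩
  · rintro ⟨h, h'⟩
    rw [h, h', max_self]

end Aut

namespace Term

variable {G : Type u}

theorem map_eval {H K : Type*} [Group H] [Lattice H] [Group K] [Lattice K]
    {f : H →* K} (hf : IsLHom f) (p : G → H) (t : Term G) :
    f (t.eval p) = t.eval (f ∘ p) := by
  induction t with
  | of a => rfl
  | one => exact map_one f
  | mul s t hs ht => simp [eval, hs, ht]
  | inv t ht => simp [eval, ht]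
  | sup s t hs ht => simp [eval, hs, ht, hf.1]
  | inf s t hs ht => simp [eval, hs, ht, hf.2]

variable {Ω Ω' : Type*} [LinearOrder Ω] [LinearOrder Ω']

theorem eval_equivariant {π : Ω → Ω'} (hπ : Monotone π) {ρ : G → Aut Ω} {ρ' : G → Aut Ω'}
    (h : ∀ a x, π (ρ a x) = ρ' a (π x)) (t : Term G) (x : Ω) :
    π (t.eval ρ x) = t.eval ρ' (π x) := by
  induction t generalizing x with
  | of a => exact h a x
  | one => rfl
  | mul s t hs ht => simp [eval, hs, ht]
  | inv t ht =>
    apply (t.eval ρ').injective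
    simp [eval, ← ht]
  | sup s t hs ht => simp [eval, hs, ht, hπ.map_max]
  | inf s t hs ht => simp [eval, hs, ht, hπ.map_min]

theorem eval_apply_eq_of_forall {ρ : G → Aut Ω} {x : Ω} (h : ∀ a, ρ a x = x) (t : Term G) :
    t.eval ρ x = x :=
  (eval_equivariant (π := fun _ : Unit => x) (ρ := fun _ => 1) monotone_const
    (fun a _ => (h a).symm) t ()).symm

end Term

/-! ### Prime pre-cones on `ℓ`-groups -/

theorem infClosed_sUnion_of_isChain {α : Type*} [SemilatticeInf α] {c : Set (Set α)}
    (hc : IsChain (· ⊆ ·) c) (h : ∀ s ∈ c, InfClosed s) : InfClosed (⋃₀ c) := by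
  rintro u ⟨s, hs, hu⟩ v ⟨t, ht, hv⟩
  obtain ⟨r, hr, hsr, htr⟩ := hc.directedOn s hs t ht
  exact ⟨r, hr, h r hr (hsr hu) (htr hv)⟩

theorem exists_maximal_infClosed {α : Type*} [SemilatticeInf α] {b x : α} (hx : b < x) :
    ∃ U : Set α, x ∈ U ∧ U ⊆ Set.Ioi b ∧ InfClosed U ∧
      ∀ v, b ≤ v → v ∉ U → ∃ u ∈ U, v ⊓ u = b := by
  obtain ⟨U, hxU, hU⟩ := zorn_subset_nonempty {U : Set α | U ⊆ Set.Ioi b ∧ InfClosed U}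
    (fun c hc hchain _ => ⟨⋃₀ c, ⟨Set.sUnion_subset fun s hs => (hc hs).1,
      infClosed_sUnion_of_isChain hchain fun s hs => (hc hs).2⟩,
      fun s hs => Set.subset_sUnion_of_mem hs⟩)
    {x} ⟨by simpa using hx, infClosed_singleton⟩
  refine ⟨U, hxU rfl, hU.prop.1, hU.prop.2, fun v hv hvU => ?_⟩
  by_contra! hne
  -- Otherwise the filter generated by `v` and `U` is a larger candidate.
  let U' : Set α := {w | ∃ u ∈ U, v ⊓ u ≤ w}
  have hU' : U' ⊆ Set.Ioi b ∧ InfClosed U' := by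
    refine ⟨?_, ?_⟩
    · rintro w ⟨u, hu, huw⟩
      exact (lt_of_le_of_ne (le_inf hv (hU.prop.1 hu).le) (hne u hu).symm).trans_le huw
    · rintro w ⟨u, hu, huw⟩ w' ⟨u', hu', huw'⟩
      refine ⟨u ⊓ u', hU.prop.2 hu hu', ?_⟩
      rw [inf_inf_distrib_left]
      exact inf_le_inf huw huw'
  exact hvU (hU.le_of_ge hU' (fun u hu => ⟨u, hu, inf_le_right⟩) ⟨x, hxU rfl, inf_le_left⟩)

theorem mul_inf_eq_one {H : Type*} [Group H] [Lattice H] [MulLeftMono H] [MulRightMono H]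
    {a b u : H} (ha : a ⊓ u = 1) (hb : b ⊓ u = 1) : a * b ⊓ u = 1 := by
  have ha1 : 1 ≤ a := ha ▸ inf_le_left
  have hb1 : 1 ≤ b := hb ▸ inf_le_left
  have hu1 : 1 ≤ u := hb ▸ inf_le_right
  have hle : a * b ⊓ u ≤ b := calc
    a * b ⊓ u ≤ a * b ⊓ u * b := inf_le_inf_left _ (le_mul_of_one_le_right' hb1)
    _ = b := by rw [← inf_mul, ha, one_mul]
  exact le_antisymm (hb ▸ le_inf hle inf_le_right) (le_inf (one_le_mul ha1 hb1) hu1)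

theorem leOnePart_mul_le {H : Type*} [Group H] [Lattice H] [MulLeftMono H] [MulRightMono H]
    (a b : H) : (a * b)⁻ᵐ ≤ b⁻ᵐ * a⁻ᵐ := by
  rw [leOnePart_def, mul_inv_rev]
  exact sup_le (mul_le_mul' (inv_le_leOnePart b) (inv_le_leOnePart a))
    (one_le_mul (one_le_leOnePart b) (one_le_leOnePart a))

namespace PreCone

/-- A right pre-order on an `ℓ`-group is prime if its classes are compatible with the lattice
operations, so that its right regular representation is an `ℓ`-homomorphism. -/
def IsPrime {H : Type*} [Group H] [Lattice H] (C : PreCone H) : Prop := ∀ a ∈ C, a ⊓ 1 ∈ C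

variable {H : Type u} [Group H] [Lattice H] [MulLeftMono H] [MulRightMono H]

theorem IsPrime.isLHom_R {C : PreCone H} (hC : C.IsPrime) : IsLHom C.R := by
  have cls_sup {a b : H} (hab : C.cls a ≤ C.cls b) : C.cls (a ⊔ b) = C.cls b := by
    refine le_antisymm ?_ (C.cls_le_cls.2 (C.mem_of_one_le (by simp)))
    have hinf : b * (a ⊔ b)⁻¹ = b * a⁻¹ ⊓ 1 := by rw [inv_sup, mul_inf, mul_inv_cancel]
    rw [C.cls_le_cls, hinf]
    exact hC _ hab
  refine .of_map_sup fun a b => Aut.ext fun x => ?_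
  obtain ⟨c, rfl⟩ := C.cls_surjective x
  simp only [R_apply_cls, Aut.sup_apply, mul_sup]
  rcases le_total (C.cls (c * a)) (C.cls (c * b)) with h | h
  · rw [max_eq_right h, cls_sup h]
  · rw [max_eq_left h, sup_comm, cls_sup h]

theorem IsPrime.eval_comp {X : Type u} {C : PreCone H} (hC : C.IsPrime) (p : X → H) (t : Term X) :
    t.eval (C.R ∘ p) (C.cls 1) = C.cls (t.eval p) := by
  rw [← Term.map_eval hC.isLHom_R, R_apply_cls, one_mul]

/-- The prime pre-cone `{h | h⁻ᵐ ∉ U}` given by a maximal set `U` of strictly positive elements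
closed under meets. -/
def ofInfClosed (U : Set H) (hne : U.Nonempty) (hpos : U ⊆ Set.Ioi 1) (hinf : InfClosed U)
    (hmax : ∀ v, 1 ≤ v → v ∉ U → ∃ u ∈ U, v ⊓ u = 1) : PreCone H where
  carrier := {h | h⁻ᵐ ∉ U}
  one_mem' h := (hpos h).ne' (leOnePart_one (α := H))
  mul_mem' {a b} ha hb hab := by
    obtain ⟨u, hu, hau⟩ := hmax _ (one_le_leOnePart a) ha
    obtain ⟨v, hv, hbv⟩ := hmax _ (one_le_leOnePart b) hb
    have huv : 1 < u ⊓ v := hpos (hinf hu hv)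
    have hmul : b⁻ᵐ * a⁻ᵐ ⊓ (u ⊓ v) = 1 := mul_inf_eq_one
      (le_antisymm (hbv ▸ inf_le_inf_left _ inf_le_right) (le_inf (one_le_leOnePart b) huv.le))
      (le_antisymm (hau ▸ inf_le_inf_left _ inf_le_left) (le_inf (one_le_leOnePart a) huv.le))
    exact (hpos (hinf hab (hinf hu hv))).not_ge
      (hmul ▸ inf_le_inf_right _ (leOnePart_mul_le a b))
  pos_mem' a ha h := (hpos h).ne' (leOnePart_eq_one.2 ha)
  total' a := by
    by_contra! h
    have hmem := hinf (not_not.1 h.2) (not_not.1 h.1)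
    rw [leOnePart_inv, oneLePart_inf_leOnePart_eq_one] at hmem
    exact (hpos hmem).ne' rfl
  proper' := hne.imp' (·⁻¹) fun x hx h =>
    h (by rwa [leOnePart_inv, oneLePart_of_one_le (hpos hx).le])

theorem exists_isPrime_cls_ne {x : H} (hx : x ≠ 1) :
    ∃ C : PreCone H, C.IsPrime ∧ C.cls x ≠ C.cls 1 := by
  have hx1 : 1 < |x|ₘ :=
    lt_of_le_of_ne (one_le_mabs x) fun h => hx (eq_one_of_mabs_eq_one h.symm)
  obtain ⟨U, hxU, hpos, hinf, hmax⟩ := exists_maximal_infClosed hx1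
  let C := ofInfClosed U ⟨_, hxU⟩ hpos hinf hmax
  have hC : C.IsPrime := fun a (ha : a⁻ᵐ ∉ U) => show (a ⊓ 1)⁻ᵐ ∉ U by
    rwa [leOnePart_def, inv_inf, inv_one, sup_assoc, sup_idem, ← leOnePart_def]
  refine ⟨C, hC, fun h => ?_⟩
  have hR : C.R |x|ₘ (C.cls 1) = C.cls 1 := by
    rw [hC.isLHom_R.map_mabs, Aut.mabs_apply_eq, R_apply_cls, one_mul, h]
  rw [R_apply_cls, one_mul, cls_eq_one] at hR
  refine hR.2 ?_
  rwa [leOnePart_inv, oneLePart_of_one_le hx1.le]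

end PreCone

/-! ### Principal polars and support maps -/

section Support

variable {H B : Type*} [Group H] [Lattice H] [BooleanAlgebra B]

/-- A support map of an `ℓ`-group: a surjection onto a Boolean algebra that turns orthogonality
into disjointness. It identifies the Boolean algebra with the set of principal polars. -/
structure IsSupportMap (D : H → B) : Prop where
  surjective : Function.Surjective D
  disjoint_iff : ∀ x y, Disjoint (D x) (D y) ↔ |x|ₘ ⊓ |y|ₘ = 1

theorem polar_union (S T : Set H) : polar (S ∪ T) = polar S ∩ polar T := by
  ext y
  simp only [polar, Set.mem_union, or_imp, forall_and, Set.mem_ofPred_eq, Set.mem_inter_iff]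

namespace IsSupportMap

variable {D : H → B} (hD : IsSupportMap D)
include hD

theorem eq_bot_iff [MulLeftMono H] {x : H} : D x = ⊥ ↔ x = 1 := by
  rw [← disjoint_self, hD.disjoint_iff, inf_idem]
  exact ⟨eq_one_of_mabs_eq_one, fun h => by simp [h, mabs]⟩

theorem mem_polar {S : Set H} {y : H} : y ∈ polar S ↔ ∀ x ∈ S, Disjoint (D y) (D x) :=
  forall₂_congr fun x _ => (hD.disjoint_iff y x).symm

theorem polar_setOf_le (b : B) : polar {z | D z ≤ b} = {z | D z ≤ bᶜ} := by
  ext y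
  rw [hD.mem_polar, Set.mem_ofPred_eq, le_compl_iff_disjoint_right]
  refine ⟨fun h => ?_, fun h x hx => h.mono_right hx⟩
  obtain ⟨x, rfl⟩ := hD.surjective b
  exact h x le_rfl

theorem polar_singleton (x : H) : polar {x} = {z | D z ≤ (D x)ᶜ} := by
  ext y
  rw [hD.mem_polar, Set.mem_ofPred_eq, le_compl_iff_disjoint_right]
  simp

theorem mem_principalPolars {T : Set H} : T ∈ principalPolars H ↔ ∃ b, T = {z | D z ≤ b} := by
  simp_rw [hD.surjective.exists, principalPolars, hD.polar_singleton, hD.polar_setOf_le,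
    compl_compl, Set.mem_ofPred_eq]

theorem isBooleanSubalgebraOfPolars [MulLeftMono H] :
    IsBooleanSubalgebraOfPolars (principalPolars H) where
  subset := by
    rintro _ ⟨x, rfl⟩
    exact ⟨_, rfl⟩
  top_mem := hD.mem_principalPolars.2 ⟨⊤, by simp⟩
  bot_mem := hD.mem_principalPolars.2 ⟨⊥, by ext z; simp [hD.eq_bot_iff]⟩
  inf_mem S hS T hT := by
    obtain ⟨b, rfl⟩ := hD.mem_principalPolars.1 hS
    obtain ⟨c, rfl⟩ := hD.mem_principalPolars.1 hT
    exact hD.mem_principalPolars.2 ⟨b ⊓ c, by ext z; simp⟩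
  sup_mem S hS T hT := by
    obtain ⟨b, rfl⟩ := hD.mem_principalPolars.1 hS
    obtain ⟨c, rfl⟩ := hD.mem_principalPolars.1 hT
    have hinter : {z | D z ≤ bᶜ} ∩ {z | D z ≤ cᶜ} = {z | D z ≤ (b ⊔ c)ᶜ} := by ext z; simp
    refine hD.mem_principalPolars.2 ⟨b ⊔ c, ?_⟩
    rw [polar_union, hD.polar_setOf_le, hD.polar_setOf_le, hinter, hD.polar_setOf_le, compl_compl]
  compl_mem T hT := by
    obtain ⟨b, rfl⟩ := hD.mem_principalPolars.1 hT
    exact hD.mem_principalPolars.2 ⟨bᶜ, hD.polar_setOf_le b⟩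

theorem nonempty_orderIso_principalPolars : Nonempty (B ≃o principalPolars H) := by
  let f : B ↪o principalPolars H := OrderEmbedding.ofMapLEIff
    (fun b => ⟨{z | D z ≤ b}, hD.mem_principalPolars.2 ⟨b, rfl⟩⟩) fun b c => by
      refine ⟨fun h => ?_, fun h z hz => le_trans hz h⟩
      obtain ⟨x, rfl⟩ := hD.surjective b
      exact h (le_refl (D x))
  refine ⟨RelIso.ofSurjective f ?_⟩
  rintro ⟨T, hT⟩
  obtain ⟨b, rfl⟩ := hD.mem_principalPolars.1 hT
  exact ⟨b, rfl⟩

end IsSupportMap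

end Support

/-! ### Stone duality -/

section Stone

open TopologicalSpace

namespace StoneDual

/-- The prime ideal of the elements whose image under `e` lies in a given prime ideal. -/
def comap {D E : Type*} [Preorder D] [Preorder E] (e : D ≃o E) (I : StoneDual E) :
    StoneDual D where
  val :=
    { carrier := e ⁻¹' I.1
      lower' := fun _ _ hab ha => I.1.lower (e.monotone hab) ha
      nonempty' := I.1.nonempty.preimage e.surjective
      directed' := fun a ha b hb => by
        obtain ⟨c, hc, hac, hbc⟩ := I.1.directed _ ha _ hb
        exact ⟨e.symm c, by simpa using hc, e.le_symm_apply.2 hac, e.le_symm_apply.2 hbc⟩ }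
  property :=
    { ne_univ := fun h => I.2.ne_univ (e.surjective.preimage_injective h)
      compl_filter := by
        let F := I.2.compl_filter.toPFilter
        refine .of_def (F.nonempty.preimage e.surjective) (fun a ha b hb => ?_)
          fun hab ha => F.mem_of_le (e.monotone hab) ha
        obtain ⟨c, hc, hca, hcb⟩ := F.directed _ ha _ hb
        exact ⟨e.symm c, show e (e.symm c) ∉ I.1 by rwa [e.apply_symm_apply],
          e.symm_apply_le.2 hca, e.symm_apply_le.2 hcb⟩ }

theorem continuous_comap {D E : Type*} [Preorder D] [Preorder E] (e : D ≃o E) :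
    Continuous (comap e) := by
  refine continuous_generateFrom_iff.2 ?_
  rintro _ ⟨a, rfl⟩
  exact isOpen_generateFrom_of_mem ⟨e a, rfl⟩

/-- The Stone duals of isomorphic ordered sets are homeomorphic. -/
def congr {D E : Type*} [Preorder D] [Preorder E] (e : D ≃o E) : StoneDual E ≃ₜ StoneDual D where
  toFun := comap e
  invFun := comap e.symm
  left_inv I := Subtype.ext (SetLike.coe_injective (e.symm_preimage_preimage I.1))
  right_inv I := Subtype.ext (SetLike.coe_injective (e.preimage_symm_preimage I.1))
  continuous_toFun := continuous_comap e
  continuous_invFun := continuous_comap e.symm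

variable {X : Type*} [TopologicalSpace X]

/-- The prime ideal of the clopen sets that omit a given point. -/
def ofPoint (x : X) : StoneDual (Clopens X) :=
  let I : Order.Ideal (Clopens X) :=
    { carrier := {U | x ∉ U}
      lower' := fun _ _ hVU hxU hxV => hxU (hVU hxV)
      nonempty' := ⟨⊥, Set.notMem_empty x⟩
      directed' := fun U hU V hV => ⟨U ⊔ V, fun h => h.elim hU hV, le_sup_left, le_sup_right⟩ }
  have : I.IsProper := Order.Ideal.isProper_of_notMem (p := ⊤) fun h => h (Set.mem_univ x)
  ⟨I, Order.Ideal.isPrime_of_mem_or_compl_mem fun {U} =>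
    (em (x ∉ U)).imp_right fun hU hUc => hUc (not_not.1 hU)⟩

theorem continuous_ofPoint : Continuous (ofPoint (X := X)) := by
  refine continuous_generateFrom_iff.2 ?_
  rintro _ ⟨U, rfl⟩
  convert U.isClopen.isOpen using 1
  ext x
  exact not_not

theorem ofPoint_injective [TotallySeparatedSpace X] :
    Function.Injective (ofPoint (X := X)) := by
  intro x y hxy
  by_contra hne
  obtain ⟨U, hU, hxU, hyU⟩ := exists_isClopen_of_totally_separated hne
  have hUy : (⟨U, hU⟩ : Clopens X) ∈ (ofPoint y).1 := hyU
  rw [← hxy] at hUy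
  exact hUy hxU

theorem exists_forall_notMem_of_isProper [CompactSpace X] {I : Order.Ideal (Clopens X)}
    (hI : I.IsProper) : ∃ x, ∀ U ∈ I, x ∉ U := by
  by_contra! hcover
  have : Nonempty I := I.nonempty.to_subtype
  obtain ⟨U, hU⟩ := isCompact_univ.elim_directed_cover (fun U : I => (U.1 : Set X))
    (fun U => U.1.isClopen.isOpen)
    (fun x _ => by
      obtain ⟨U, hU, hxU⟩ := hcover x
      exact Set.mem_iUnion.2 ⟨⟨U, hU⟩, hxU⟩)
    (directedOn_iff_directed.1 I.directed)
  exact hI.ne_univ (Set.eq_univ_of_forall fun V =>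
    I.lower (fun x _ => hU (Set.mem_univ x)) U.2)

theorem ofPoint_surjective [CompactSpace X] : Function.Surjective (ofPoint (X := X)) := by
  rintro ⟨I, hI⟩
  obtain ⟨x, hx⟩ := exists_forall_notMem_of_isProper hI.toIsProper
  refine ⟨x, Subtype.ext (Order.Ideal.ext (Set.ext fun U => ⟨fun hxU => ?_, hx U⟩))⟩
  exact hI.mem_or_compl_mem.resolve_right fun hUc => hx _ hUc hxU

theorem notMem_or_compl_notMem {B : Type*} [BooleanAlgebra B] (I : StoneDual B) (b : B) :
    b ∉ I.1 ∨ bᶜ ∉ I.1 := by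
  by_contra! h
  exact I.2.ne_univ (Set.eq_univ_of_forall fun c =>
    I.1.lower (le_top.trans sup_compl_eq_top.ge) (I.1.sup_mem h.1 h.2))

theorem exists_mem_notMem_of_ne {B : Type*} [BooleanAlgebra B] {I J : StoneDual B} (h : I ≠ J) :
    ∃ b, b ∈ I.1 ∧ b ∉ J.1 := by
  by_contra! hle
  refine h (Subtype.ext (Order.Ideal.ext (Set.Subset.antisymm hle fun b hb => ?_)))
  refine I.2.mem_or_compl_mem.resolve_right fun hbc => ?_
  exact (notMem_or_compl_notMem J b).elim (· hb) (· (hle _ hbc))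

instance {B : Type*} [BooleanAlgebra B] : T2Space (StoneDual B) where
  t2 I J hIJ := by
    obtain ⟨b, hbI, hbJ⟩ := exists_mem_notMem_of_ne hIJ
    exact ⟨{K | bᶜ ∉ K.1}, {K | b ∉ K.1}, isOpen_generateFrom_of_mem ⟨_, rfl⟩,
      isOpen_generateFrom_of_mem ⟨_, rfl⟩, (notMem_or_compl_notMem I b).resolve_left (· hbI), hbJ,
      Set.disjoint_left.2 fun K hbc hb => hb (K.2.mem_or_compl_mem.resolve_right hbc)⟩

/-- A Stone space is homeomorphic to the Stone dual of its algebra of clopen sets. -/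
noncomputable def homeomorph [CompactSpace X] [TotallySeparatedSpace X] :
    X ≃ₜ StoneDual (Clopens X) :=
  continuous_ofPoint.homeoOfEquivCompactToT2
    (f := Equiv.ofBijective ofPoint ⟨ofPoint_injective, ofPoint_surjective⟩)

end StoneDual

end Stone

/-! ### Invariant right pre-orders -/

section Invariant

open Filter Topology TopologicalSpace

variable {G : Type u} [Group G] [PartialOrder G]

/-- The right pre-orders that are invariant under conjugation by `S` and for which the elements of
`N` are equivalent to `1`. -/
def invariantPreorders (N S : Subgroup G) : Set (PreCone G) := {C | N ≤ C.core ∧ C.IsInvariant S}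

/-- The right pre-orders that are invariant under conjugation by `S` and for which precisely the
elements of `N` are equivalent to `1`. For normal `N` and `S = ⊤` these are the orders on `G ⧸ N`,
for normal `N` and `S = ⊥` its right orders. -/
def invariantOrders (N S : Subgroup G) : Set (PreCone G) := {C | C.core = N ∧ C.IsInvariant S}

variable {N S : Subgroup G}

theorem invariantOrders_subset : invariantOrders N S ⊆ invariantPreorders N S :=
  fun _ hC => ⟨hC.1.ge, hC.2⟩

theorem rightOrders_eq : rightOrders G = invariantOrders ⊥ ⊥ := by
  ext C
  rw [invariantOrders, Set.mem_ofPred_eq, and_iff_left C.isInvariant_bot, eq_bot_iff]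
  exact ⟨fun h a ha => h a ha.1 ha.2, fun h a ha ha' => h ⟨ha, ha'⟩⟩

theorem orders_eq : orders G = invariantOrders ⊥ ⊤ := by
  ext C
  rw [orders, rightOrders_eq]
  exact ⟨fun h => ⟨h.1.1, fun a ha b _ => h.2 a ha b⟩,
    fun h => ⟨⟨h.1, C.isInvariant_bot⟩, fun a ha b => h.2 a ha b trivial⟩⟩

namespace PreCone

theorem IsInvariant.conj_mem_iff {C : PreCone G} (hC : C.IsInvariant S) {a b : G} (hb : b ∈ S) :
    b * a * b⁻¹ ∈ C ↔ a ∈ C :=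
  ⟨fun h => by simpa [mul_assoc] using hC _ h _ (inv_mem hb), fun h => hC a h b hb⟩

/-- The right pre-order `C`, refined by `D` on the elements equivalent to `1`. -/
def refine (C D : PreCone G) : PreCone G where
  carrier := {a | a ∈ C ∧ (a⁻¹ ∈ C → a ∈ D)}
  one_mem' := ⟨C.one_mem, fun _ => D.one_mem⟩
  mul_mem' := by
    rintro a b ⟨ha, ha'⟩ ⟨hb, hb'⟩
    refine ⟨C.mul_mem ha hb, fun h => D.mul_mem (ha' ?_) (hb' ?_)⟩
    · simpa using C.mul_mem hb h
    · simpa using C.mul_mem h ha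
  pos_mem' a ha := ⟨C.mem_of_one_le ha, fun _ => D.mem_of_one_le ha⟩
  total' a := by
    change (a ∈ C ∧ (a⁻¹ ∈ C → a ∈ D)) ∨ (a⁻¹ ∈ C ∧ (a⁻¹⁻¹ ∈ C → a⁻¹ ∈ D))
    rw [inv_inv]
    have := C.total a
    have := D.total a
    tauto
  proper' := C.proper'.imp fun _ ha h => ha h.1

theorem refine_le (C D : PreCone G) : C.refine D ≤ C := fun _ ha => ha.1

theorem core_refine_le (C D : PreCone G) : (C.refine D).core ≤ D.core :=
  fun _ ha => ⟨ha.1.2 ha.2.1, ha.2.2 (by simpa using ha.1.1)⟩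

theorem refine_mem_invariantPreorders {C D : PreCone G} (hC : C ∈ invariantPreorders N S)
    (hD : D ∈ invariantPreorders N S) : C.refine D ∈ invariantPreorders N S := by
  refine ⟨fun a ha => ⟨⟨(hC.1 ha).1, fun _ => (hD.1 ha).1⟩, (hC.1 ha).2, fun _ => (hD.1 ha).2⟩, ?_⟩
  rintro a ⟨haC, haD⟩ b hb
  refine ⟨hC.2 a haC b hb, fun h => hD.2 a (haD ?_) b hb⟩
  rwa [conj_inv, hC.2.conj_mem_iff hb] at h

/-- The intersection of a nonempty chain of right pre-orders. -/
def sInfOfIsChain {c : Set (PreCone G)} (hc : IsChain (· ≤ ·) c) (hne : c.Nonempty) :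
    PreCone G where
  carrier := {a | ∀ C ∈ c, a ∈ C}
  one_mem' C _ := C.one_mem
  mul_mem' ha hb C hC := C.mul_mem (ha C hC) (hb C hC)
  pos_mem' a ha C _ := C.mem_of_one_le ha
  total' a := by
    by_contra! h
    simp only [Set.mem_ofPred_eq, not_forall] at h
    obtain ⟨⟨C, hC, haC⟩, D, hD, haD⟩ := h
    rcases hc.total hC hD with hle | hle
    · exact haD (hle (C.inv_mem_of_notMem haC))
    · exact haC (hle ((D.total a).resolve_right haD))
  proper' := by
    obtain ⟨C, hC⟩ := hne
    exact C.proper'.imp fun a ha h => ha (h C hC)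

end PreCone

theorem exists_minimal_invariantPreorder_le {C : PreCone G} (hC : C ∈ invariantPreorders N S) :
    ∃ D ≤ C, Minimal (· ∈ invariantPreorders N S) D := by
  obtain ⟨D, hDC, hD⟩ := zorn_le_nonempty₀ (α := (PreCone G)ᵒᵈ) (invariantPreorders N S)
    (fun c hc hchain C hC => ⟨PreCone.sInfOfIsChain hchain.symm ⟨C, hC⟩,
      ⟨fun a ha => ⟨fun D hD => ((hc hD).1 ha).1, fun D hD => ((hc hD).1 ha).2⟩,
        fun a ha b hb D hD => (hc hD).2 a (ha D hD) b hb⟩, fun D hD a ha => ha D hD⟩) C hC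
  exact ⟨D, hDC, hD.prop, fun E hE h => hD.le_of_ge hE h⟩

theorem exists_invariantOrder_le
    (hsep : ∀ a ∉ N, ∃ E ∈ invariantPreorders N S, a ∉ E.core) {C : PreCone G}
    (hC : C ∈ invariantPreorders N S) : ∃ D ∈ invariantOrders N S, D ≤ C := by
  obtain ⟨D, hDC, hD⟩ := exists_minimal_invariantPreorder_le hC
  refine ⟨D, ⟨le_antisymm (fun a ha => ?_) hD.prop.1, hD.prop.2⟩, hDC⟩
  by_contra haN
  obtain ⟨E, hE, haE⟩ := hsep a haN
  have hle : D ≤ D.refine E :=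
    hD.2 (PreCone.refine_mem_invariantPreorders hD.prop hE) (D.refine_le E)
  exact haE (D.core_refine_le E (PreCone.core_mono hle ha))

/-! ### The topology of the space of invariant orders -/

theorem PreCone.isOpen_P (a : G) : IsOpen (P a) := isOpen_generateFrom_of_mem ⟨a, rfl⟩

namespace invariantOrders

theorem isClopen_mem (a : G) : IsClopen {C : invariantOrders N S | a ∈ C.1} := by
  have hopen : ∀ b : G, IsOpen {C : invariantOrders N S | C.1 ∈ PreCone.P b} := fun b =>
    (PreCone.isOpen_P b).preimage continuous_subtype_val
  constructor
  · rw [← isOpen_compl_iff]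
    convert hopen a⁻¹ using 1
    ext C
    change a ∉ C.1 ↔ a⁻¹ ∈ C.1 ∧ a⁻¹⁻¹ ∉ C.1
    rw [inv_inv]
    exact ⟨fun h => ⟨C.1.inv_mem_of_notMem h, h⟩, fun h => h.2⟩
  · by_cases ha : a ∈ N
    · convert isOpen_univ
      exact Set.eq_univ_of_forall fun C => (C.2.1.ge ha).1
    · convert hopen a using 1
      ext C
      exact ⟨fun h => ⟨h, fun h' => ha (C.2.1.le ⟨h, h'⟩)⟩, fun h => h.1⟩

theorem exists_mem_P_notMem_of_ne {C D : invariantOrders N S} (h : C ≠ D) :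
    ∃ a, C.1 ∈ PreCone.P a ∧ a ∉ D.1 := by
  by_contra! hcon
  have hCD : C.1 ≤ D.1 := fun a ha => by
    by_cases ha' : a⁻¹ ∈ C.1
    · exact (D.2.1.ge (C.2.1.le ⟨ha, ha'⟩)).1
    · exact hcon a ⟨ha, ha'⟩
  refine h (Subtype.ext (le_antisymm hCD fun a ha => ?_))
  by_contra haC
  exact haC (C.2.1.ge (D.2.1.le ⟨ha, hCD (C.1.inv_mem_of_notMem haC)⟩)).1

instance : TotallySeparatedSpace (invariantOrders N S) :=
  totallySeparatedSpace_iff_exists_isClopen.2 fun C D h => by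
    obtain ⟨a, ha, haD⟩ := exists_mem_P_notMem_of_ne h
    exact ⟨_, isClopen_mem a, ha.1, haD⟩

theorem exists_eventually_notMem (U : Ultrafilter (invariantOrders N S)) :
    ∃ a, ∀ᶠ C : invariantOrders N S in U, a ∉ C.1 := by
  obtain ⟨C₀⟩ := (U : Filter (invariantOrders N S)).nonempty_of_neBot
  obtain ⟨a, ha⟩ := C₀.1.proper'
  have haN : a ∉ N := fun h => ha (C₀.2.1.ge h).1
  have hU : ∀ᶠ C : invariantOrders N S in U, a ∉ C.1 ∨ a⁻¹ ∉ C.1 :=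
    .of_forall fun C => not_and_or.1 fun h => haN (C.2.1.le h)
  exact (Ultrafilter.eventually_or.1 hU).elim (fun h => ⟨a, h⟩) fun h => ⟨a⁻¹, h⟩

instance : CompactSpace (invariantOrders N S) where
  isCompact_univ := by
    refine isCompact_iff_ultrafilter_le_nhds.2 fun U _ => ?_
    let C := PreCone.ultralimit U (fun D => D.1.toSubmonoid)
      (fun a ha => .of_forall fun D => D.1.mem_of_one_le ha)
      (fun a => .of_forall fun D => D.1.total a) (exists_eventually_notMem U)
    have hcore : C.core = N := by
      refine le_antisymm (fun a ha => ?_) fun a ha =>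
        ⟨.of_forall fun D => (D.2.1.ge ha).1, .of_forall fun D => (D.2.1.ge ha).2⟩
      obtain ⟨D, hD⟩ := (Eventually.and ha.1 ha.2).exists
      exact D.2.1.le hD
    refine ⟨⟨C, hcore, fun a ha b hb => Eventually.mono ha fun D h => D.2.2 a h b hb⟩, trivial, ?_⟩
    rw [nhds_subtype, ← map_le_iff_le_comap]
    refine tendsto_nhds_generateFrom_iff.2 ?_
    rintro _ ⟨a, rfl⟩ ⟨h, h'⟩
    exact Eventually.and h (Ultrafilter.eventually_not.2 h')

theorem isStoneSpace : IsStoneSpace (invariantOrders N S) :=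
  ⟨inferInstance, inferInstance, inferInstance⟩

section Eval

variable {C : invariantOrders N S}

theorem cls_eq_cls {a b : G} : C.1.cls a = C.1.cls b ↔ b * a⁻¹ ∈ N := by
  rw [C.1.cls_eq_cls_iff_mem_core, C.2.1]

theorem eventually_cls_eq {a b : G} (h : C.1.cls a = C.1.cls b) :
    ∀ᶠ D : invariantOrders N S in 𝓝 C, D.1.cls a = D.1.cls b :=
  .of_forall fun _ => cls_eq_cls.2 (cls_eq_cls.1 h)

theorem eventually_cls_le {a b : G} (h : C.1.cls a ≤ C.1.cls b) :
    ∀ᶠ D : invariantOrders N S in 𝓝 C, D.1.cls a ≤ D.1.cls b :=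
  (isClopen_mem (b * a⁻¹)).isOpen.mem_nhds h

theorem eventually_max_cls_eq {a b c : G} (h : max (C.1.cls a) (C.1.cls b) = C.1.cls c) :
    ∀ᶠ D : invariantOrders N S in 𝓝 C, max (D.1.cls a) (D.1.cls b) = D.1.cls c := by
  rcases max_eq_iff.1 h with ⟨hc, hle⟩ | ⟨hc, hle⟩
  · filter_upwards [eventually_cls_eq hc, eventually_cls_le hle] with D hD hD'
    rw [max_eq_left hD', hD]
  · filter_upwards [eventually_cls_eq hc, eventually_cls_le hle] with D hD hD'
    rw [max_eq_right hD', hD]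

theorem eventually_min_cls_eq {a b c : G} (h : min (C.1.cls a) (C.1.cls b) = C.1.cls c) :
    ∀ᶠ D : invariantOrders N S in 𝓝 C, min (D.1.cls a) (D.1.cls b) = D.1.cls c := by
  rcases min_eq_iff.1 h with ⟨hc, hle⟩ | ⟨hc, hle⟩
  · filter_upwards [eventually_cls_eq hc, eventually_cls_le hle] with D hD hD'
    rw [min_eq_left hD', hD]
  · filter_upwards [eventually_cls_eq hc, eventually_cls_le hle] with D hD hD'
    rw [min_eq_right hD', hD]

theorem eventually_eval_cls_eq (t : Term G) {a b : G} (h : t.eval C.1.R (C.1.cls a) = C.1.cls b) :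
    ∀ᶠ D : invariantOrders N S in 𝓝 C, t.eval D.1.R (D.1.cls a) = D.1.cls b := by
  induction t generalizing a b with
  | of c => exact eventually_cls_eq h
  | one => exact eventually_cls_eq h
  | mul s t hs ht =>
    obtain ⟨c, hc⟩ := C.1.cls_surjective (s.eval C.1.R (C.1.cls a))
    rw [Term.eval, Aut.mul_apply, ← hc] at h
    filter_upwards [hs hc.symm, ht h] with D hD hD'
    rw [Term.eval, Aut.mul_apply, hD, hD']
  | inv t ht =>
    rw [Term.eval, Aut.inv_apply_eq, eq_comm] at h
    filter_upwards [ht h] with D hD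
    rw [Term.eval, Aut.inv_apply_eq, hD]
  | sup s t hs ht =>
    obtain ⟨c, hc⟩ := C.1.cls_surjective (s.eval C.1.R (C.1.cls a))
    obtain ⟨d, hd⟩ := C.1.cls_surjective (t.eval C.1.R (C.1.cls a))
    rw [Term.eval, Aut.sup_apply, ← hc, ← hd] at h
    filter_upwards [hs hc.symm, ht hd.symm, eventually_max_cls_eq h] with D hD hD' hmax
    rw [Term.eval, Aut.sup_apply, hD, hD', hmax]
  | inf s t hs ht =>
    obtain ⟨c, hc⟩ := C.1.cls_surjective (s.eval C.1.R (C.1.cls a))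
    obtain ⟨d, hd⟩ := C.1.cls_surjective (t.eval C.1.R (C.1.cls a))
    rw [Term.eval, Aut.inf_apply, ← hc, ← hd] at h
    filter_upwards [hs hc.symm, ht hd.symm, eventually_min_cls_eq h] with D hD hD' hmin
    rw [Term.eval, Aut.inf_apply, hD, hD', hmin]

end Eval

theorem isClopen_eval_ne (t : Term G) :
    IsClopen {C : invariantOrders N S | t.eval C.1.R (C.1.cls 1) ≠ C.1.cls 1} := by
  constructor
  · rw [← isOpen_compl_iff, isOpen_iff_eventually]
    intro C hC
    exact (eventually_eval_cls_eq t (not_not.1 hC)).mono fun D hD => not_not.2 hD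
  · rw [isOpen_iff_eventually]
    intro C hC
    obtain ⟨a, ha⟩ := C.1.cls_surjective (t.eval C.1.R (C.1.cls 1))
    filter_upwards [eventually_eval_cls_eq t ha.symm] with D hD h
    rw [hD, cls_eq_cls] at h
    exact hC (ha ▸ cls_eq_cls.2 h)

end invariantOrders

theorem exists_mem_disjoint_of_infClosed {X : Type*} [TopologicalSpace X] {F : Set (Clopens X)}
    (hF : InfClosed F) {x : X} (hcover : ∃ U ∈ F, x ∈ U) {K : Set X} (hK : IsCompact K)
    (hsep : ∀ y ∈ K, ∃ U ∈ F, x ∈ U ∧ y ∉ U) : ∃ U ∈ F, x ∈ U ∧ Disjoint K U := by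
  refine hK.induction_on (p := fun s => ∃ U ∈ F, x ∈ U ∧ Disjoint s (U : Set X)) ?_ ?_ ?_ ?_
  · obtain ⟨U, hU, hx⟩ := hcover
    exact ⟨U, hU, hx, Set.empty_disjoint _⟩
  · rintro s t hst ⟨U, hU, hx, htU⟩
    exact ⟨U, hU, hx, htU.mono_left hst⟩
  · rintro s t ⟨U, hU, hxU, hsU⟩ ⟨V, hV, hxV, htV⟩
    exact ⟨U ⊓ V, hF hU hV, ⟨hxU, hxV⟩, Set.disjoint_union_left.2
      ⟨hsU.mono_right Set.inter_subset_left, htV.mono_right Set.inter_subset_right⟩⟩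
  · intro y hy
    obtain ⟨U, hU, hx, hyU⟩ := hsep y hy
    exact ⟨(U : Set X)ᶜ, mem_nhdsWithin_of_mem_nhds (U.isClopen.compl.isOpen.mem_nhds hyU), U, hU,
      hx, disjoint_compl_left⟩

theorem clopens_mem_of_supClosed_of_infClosed {X : Type*} [TopologicalSpace X] [CompactSpace X]
    {F : Set (Clopens X)} (hsup : SupClosed F) (hinf : InfClosed F) (hbot : ⊥ ∈ F)
    (hcover : ∀ x, ∃ U ∈ F, x ∈ U) (hsep : ∀ x y, x ≠ y → ∃ U ∈ F, x ∈ U ∧ y ∉ U)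
    (W : Clopens X) : W ∈ F := by
  obtain ⟨U, hU, hWU, hUW⟩ : ∃ U ∈ F, (W : Set X) ⊆ U ∧ U ≤ W := by
    refine W.isClopen.isClosed.isCompact.induction_on
      (p := fun s => ∃ U ∈ F, s ⊆ (U : Set X) ∧ U ≤ W) ?_ ?_ ?_ ?_
    · exact ⟨⊥, hbot, Set.empty_subset _, bot_le⟩
    · rintro s t hst ⟨U, hU, htU, hUW⟩
      exact ⟨U, hU, hst.trans htU, hUW⟩
    · rintro s t ⟨U, hU, hsU, hUW⟩ ⟨V, hV, htV, hVW⟩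
      exact ⟨U ⊔ V, hsup hU hV, Set.union_subset_union hsU htV, sup_le hUW hVW⟩
    · intro x hx
      obtain ⟨U, hU, hxU, hdisj⟩ := exists_mem_disjoint_of_infClosed hinf (hcover x)
        W.isClopen.compl.isClosed.isCompact fun y hy => hsep x y fun h => hy (h ▸ hx)
      exact ⟨U, mem_nhdsWithin_of_mem_nhds (U.isClopen.isOpen.mem_nhds hxU), U, hU, subset_rfl,
        Set.disjoint_compl_left_iff_subset.1 hdisj⟩
  rwa [show W = U from le_antisymm hWU hUW]

/-! ### Invariant orders along a surjective homomorphism -/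

section Map

theorem PreCone.map_mem_image_iff {Γ : Type*} [Group Γ] {p : G →* Γ} {C : PreCone G}
    (hker : p.ker ≤ C.core) {a : G} : p a ∈ p '' (C : Set G) ↔ a ∈ C := by
  refine ⟨?_, Set.mem_image_of_mem p⟩
  rintro ⟨b, hb, hba⟩
  have hab : a * b⁻¹ ∈ p.ker := by rw [MonoidHom.mem_ker, map_mul, map_inv, hba, mul_inv_cancel]
  simpa using C.mul_mem (hker hab).1 hb

variable {Γ : Type*} [Group Γ] [PartialOrder Γ] {p : G →* Γ}

namespace PreCone

theorem ker_le_core {C : PreCone G} (hpos : ∀ a, 1 ≤ p a → a ∈ C) : p.ker ≤ C.core :=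
  fun a ha => ⟨hpos a ha.ge, hpos a⁻¹ (inv_mem ha).ge⟩

/-- The image of a pre-cone under a surjective homomorphism. -/
def map (p : G →* Γ) (hp : Function.Surjective p) (C : PreCone G)
    (hpos : ∀ a, 1 ≤ p a → a ∈ C) : PreCone Γ where
  __ := C.toSubmonoid.map p
  pos_mem' := hp.forall.2 fun a ha => ⟨a, hpos a ha, rfl⟩
  total' := hp.forall.2 fun a =>
    (C.total a).imp (fun h => ⟨a, h, rfl⟩) fun h => ⟨a⁻¹, h, map_inv p a⟩
  proper' := C.proper'.imp' p fun _ ha h => ha ((map_mem_image_iff (ker_le_core hpos)).1 h)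

theorem map_mem_map_iff {hp : Function.Surjective p} {C : PreCone G}
    {hpos : ∀ a, 1 ≤ p a → a ∈ C} {a : G} : p a ∈ map p hp C hpos ↔ a ∈ C :=
  map_mem_image_iff (ker_le_core hpos)

theorem map_mem_P_iff {hp : Function.Surjective p} {C : PreCone G}
    {hpos : ∀ a, 1 ≤ p a → a ∈ C} {a : G} : map p hp C hpos ∈ P (p a) ↔ C ∈ P a := by
  rw [P, P, Set.mem_ofPred_eq, Set.mem_ofPred_eq, ← map_inv, map_mem_map_iff, map_mem_map_iff]

theorem comap_mem_P_iff {hp : Monotone p} {D : PreCone Γ} {hD : ∃ a, p a ∉ D} {a : G} :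
    comap p hp D hD ∈ P a ↔ D ∈ P (p a) := by
  rw [P, P, Set.mem_ofPred_eq, Set.mem_ofPred_eq, mem_comap, mem_comap, map_inv]

theorem map_mem_invariantOrders {hp : Function.Surjective p} {C : PreCone G}
    {hpos : ∀ a, 1 ≤ p a → a ∈ C} (hC : C ∈ invariantOrders p.ker S) :
    map p hp C hpos ∈ invariantOrders ⊥ (S.map p) := by
  constructor
  · refine eq_bot_iff.2 (hp.forall.2 fun a ha => hC.1.le ?_)
    rwa [mem_core, ← map_inv, map_mem_map_iff, map_mem_map_iff] at ha
  · refine hp.forall.2 fun a ha => ?_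
    rintro _ ⟨b, hb, rfl⟩
    rw [← map_inv, ← map_mul, ← map_mul, map_mem_map_iff]
    exact hC.2 a (map_mem_map_iff.1 ha) b hb

theorem comap_mem_invariantOrders {hp : Monotone p} {D : PreCone Γ} {hD : ∃ a, p a ∉ D}
    (h : D ∈ invariantOrders ⊥ (S.map p)) : comap p hp D hD ∈ invariantOrders p.ker S := by
  constructor
  · ext a
    rw [mem_core, mem_comap, mem_comap, map_inv, ← mem_core, h.1, Subgroup.mem_bot,
      MonoidHom.mem_ker]
  · intro a ha b hb
    simpa using h.2 _ ha _ ⟨b, hb, rfl⟩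

end PreCone

/-- The homeomorphism `C ↦ p[C]` from the invariant orders with core `p.ker` to the invariant
orders with trivial core. -/
def invariantOrders.mapHomeomorph (hp : Function.Surjective p) (hmono : Monotone p)
    (hpos : ∀ C ∈ invariantOrders p.ker S, ∀ a, 1 ≤ p a → a ∈ C) :
    invariantOrders p.ker S ≃ₜ invariantOrders (⊥ : Subgroup Γ) (S.map p) where
  toFun C := ⟨C.1.map p hp (hpos C.1 C.2), PreCone.map_mem_invariantOrders C.2⟩
  invFun D := ⟨D.1.comap p hmono (hp.exists.1 D.1.proper'), PreCone.comap_mem_invariantOrders D.2⟩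
  left_inv C := Subtype.ext (PreCone.ext fun a =>
    PreCone.map_mem_map_iff (hp := hp) (hpos := hpos C.1 C.2))
  right_inv D := Subtype.ext (PreCone.ext (hp.forall.2 fun a =>
    PreCone.map_mem_map_iff (hp := hp) (hpos := hpos _ (PreCone.comap_mem_invariantOrders
      (hp := hmono) (hD := hp.exists.1 D.1.proper') D.2))))
  continuous_toFun := by
    refine continuous_induced_rng.2 (continuous_generateFrom_iff.2 ?_)
    rw [Set.forall_mem_range, hp.forall]
    intro a
    convert (PreCone.isOpen_P a).preimage continuous_subtype_val using 1
    ext C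
    exact PreCone.map_mem_P_iff (hp := hp) (hpos := hpos C.1 C.2)
  continuous_invFun := by
    refine continuous_induced_rng.2 (continuous_generateFrom_iff.2 ?_)
    rintro _ ⟨a, rfl⟩
    convert (PreCone.isOpen_P (p a)).preimage continuous_subtype_val using 1
    ext D
    exact PreCone.comap_mem_P_iff (hp := hmono) (hD := hp.exists.1 D.1.proper')

end Map

end Invariant

/-! ### The action of the free `ℓ`-group -/

section Action

open TopologicalSpace

variable {G : Type u} [Group G] [PartialOrder G] {V : LGroupClass.{u}}

/-- The right pre-orders that are invariant under conjugation by `S` and compatible with the kernel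
of `η` are `V`-right pre-orders, and there are enough of them: they lie below each `V`-right
pre-order and separate the elements of `F_V(G)`. -/
structure InvariantPreordersSuffice (V : LGroupClass.{u}) (S : Subgroup G) : Prop where
  subset : invariantPreorders (eta V).ker S ⊆ rightPreorders V G
  exists_le : ∀ C ∈ rightPreorders V G, ∃ D ∈ invariantPreorders (eta V).ker S, D ≤ C
  exists_eval_ne : ∀ t : Term G, (Free.mk t : Free V G) ≠ 1 →
    ∃ C ∈ invariantPreorders (eta V).ker S, t.eval C.R (C.cls 1) ≠ C.cls 1

namespace InvariantPreordersSuffice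

variable {S : Subgroup G} (hV : InvariantPreordersSuffice V S)
include hV

theorem exists_invariantOrder_le {C : PreCone G} (hC : C ∈ invariantPreorders (eta V).ker S) :
    ∃ D ∈ invariantOrders (eta V).ker S, D ≤ C := by
  refine LGrp.exists_invariantOrder_le (fun a ha => ?_) hC
  obtain ⟨E, hE, haE⟩ := hV.exists_eval_ne (.of a) ha
  refine ⟨E, hE, fun h => haE ?_⟩
  rwa [Term.eval, PreCone.R_apply_cls, one_mul, E.cls_eq_one]

theorem mem_rightPreorders {C : PreCone G} (hC : C ∈ invariantOrders (eta V).ker S) :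
    C ∈ rightPreorders V G :=
  hV.subset (invariantOrders_subset hC)

theorem exists_invariantOrder_eval_ne {t : Term G} (ht : (Free.mk t : Free V G) ≠ 1) :
    ∃ C ∈ invariantOrders (eta V).ker S, t.eval C.R (C.cls 1) ≠ C.cls 1 := by
  obtain ⟨D, hD, hDt⟩ := hV.exists_eval_ne t ht
  obtain ⟨C, hC, hCD⟩ := hV.exists_invariantOrder_le hD
  refine ⟨C, hC, fun h => hDt ?_⟩
  have hequiv := Term.eval_equivariant (C.omegaMap_monotone D (MonoidHom.id G) hCD) (ρ := C.R)
    (ρ' := D.R) (fun a => C.cls_surjective.forall.2 fun _ => rfl) t (C.cls 1)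
  rw [h] at hequiv
  exact hequiv.symm

end InvariantPreordersSuffice

/-- The right regular representation with values in `H_C`. -/
noncomputable def PreCone.toH (C : PreCone G) : G →* C.H :=
  C.R.codRestrict _ fun a => Subgroup.mem_sInf.2 fun _ hL => hL.1 ⟨a, rfl⟩

variable [MulLeftMono G] [MulRightMono G]

namespace PreCone

variable (C : PreCone G)

theorem R_monotone : Monotone C.R := by
  intro a b hab x
  obtain ⟨c, rfl⟩ := C.cls_surjective x
  refine C.cls_le_cls.2 (C.mem_of_one_le ?_)
  rw [le_mul_inv_iff_mul_le, one_mul]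
  exact mul_le_mul_right hab c

theorem toH_monotone : Monotone C.toH := fun _ _ h => C.R_monotone h

variable {C}

/-- The action of `F_V(G)` on `Ω_C` that extends the right regular representation. -/
noncomputable def act (hC : C ∈ rightPreorders V G) : Free V G →* Aut C.Omega where
  toFun x := (Free.ev hC C.toH C.toH_monotone x).1
  map_one' := rfl
  map_mul' x y := congrArg Subtype.val (Free.ev_mul hC C.toH C.toH_monotone x y)

theorem isLHom_act (hC : C ∈ rightPreorders V G) : IsLHom (act hC) :=
  ⟨fun x y => congrArg Subtype.val (Free.ev_sup hC C.toH C.toH_monotone x y),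
    fun x y => congrArg Subtype.val (Free.ev_inf hC C.toH C.toH_monotone x y)⟩

theorem act_mk (hC : C ∈ rightPreorders V G) (t : Term G) : act hC (Free.mk t) = t.eval C.R :=
  Term.map_eval (f := (lClosure (Set.range C.R)).subtype) ⟨fun _ _ => rfl, fun _ _ => rfl⟩ C.toH t

theorem act_eta (hC : C ∈ rightPreorders V G) (a : G) : act hC (eta V a) = C.R a := rfl

theorem mem_of_one_le_eta (hC : C ∈ rightPreorders V G) {a : G} (ha : 1 ≤ eta V a) : a ∈ C := by
  have h : act hC 1 (C.cls 1) ≤ act hC (eta V a) (C.cls 1) :=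
    (isLHom_act hC).monotone ha (C.cls 1)
  rwa [map_one, act_eta, Aut.one_apply, R_apply_cls, one_mul, cls_one_le] at h

theorem ker_eta_le_core (hC : C ∈ rightPreorders V G) : (eta V).ker ≤ C.core :=
  ker_le_core fun _ => mem_of_one_le_eta hC

end PreCone

namespace InvariantPreordersSuffice

variable {S : Subgroup G} (hV : InvariantPreordersSuffice V S)
include hV

theorem minimalLayer_eq : minimalLayer V G = invariantOrders (eta V).ker S := by
  ext C
  constructor
  · intro hC
    obtain ⟨D, hD, hDC⟩ := hV.exists_le C hC.prop
    obtain ⟨E, hE, hED⟩ := hV.exists_invariantOrder_le hD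
    rwa [← hC.eq_of_le (hV.mem_rightPreorders hE) (hED.trans hDC)]
  · intro hC
    refine ⟨hV.mem_rightPreorders hC, fun D hD hDC a ha => ?_⟩
    by_contra haD
    exact haD (PreCone.ker_eta_le_core hD (hC.1.le ⟨ha, hDC (D.inv_mem_of_notMem haD)⟩)).1

/-! ### The support map of the free `ℓ`-group -/

/-- The clopen set of the invariant orders `C` for which `x` moves the class `[1]` of `Ω_C`. -/
def support (x : Free V G) : Clopens (invariantOrders (eta V (G := G)).ker S) where
  carrier := {C | PreCone.act (hV.mem_rightPreorders C.2) x (C.1.cls 1) ≠ C.1.cls 1}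
  isClopen' := by
    induction x using Quotient.inductionOn with | _ t
    convert invariantOrders.isClopen_eval_ne t using 4 with C
    rw [← PreCone.act_mk (hV.mem_rightPreorders C.2)]
    rfl

theorem mem_support {x : Free V G} {C : invariantOrders (eta V (G := G)).ker S} :
    C ∈ hV.support x ↔
      PreCone.act (hV.mem_rightPreorders C.2) x (C.1.cls 1) ≠ C.1.cls 1 := Iff.rfl

theorem support_mabs_inf_mabs (x y : Free V G) :
    hV.support (|x|ₘ ⊓ |y|ₘ) = hV.support x ⊓ hV.support y := by
  ext C
  have hact := PreCone.isLHom_act (hV.mem_rightPreorders C.2)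
  change _ ≠ _ ↔ _ ≠ _ ∧ _ ≠ _
  rw [Ne, hact.2, hact.map_mabs, hact.map_mabs, Aut.mabs_inf_mabs_apply_eq, not_or]

theorem support_mabs_sup_mabs (x y : Free V G) :
    hV.support (|x|ₘ ⊔ |y|ₘ) = hV.support x ⊔ hV.support y := by
  ext C
  have hact := PreCone.isLHom_act (hV.mem_rightPreorders C.2)
  change _ ≠ _ ↔ _ ≠ _ ∨ _ ≠ _
  rw [Ne, hact.1, hact.map_mabs, hact.map_mabs, Aut.mabs_sup_mabs_apply_eq, not_and_or]

theorem support_one : hV.support 1 = ⊥ := by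
  ext C
  exact iff_false_intro fun h => h rfl

theorem support_eq_bot_iff {x : Free V G} : hV.support x = ⊥ ↔ x = 1 := by
  refine ⟨fun h => ?_, fun h => h ▸ hV.support_one⟩
  induction x using Quotient.inductionOn with | _ t
  by_contra hne
  obtain ⟨C, hC, hCt⟩ := hV.exists_invariantOrder_eval_ne hne
  have hmem : (⟨C, hC⟩ : invariantOrders (eta V).ker S) ∈ hV.support (Free.mk t) := by
    rwa [mem_support, PreCone.act_mk]
  exact (h ▸ hmem : (⟨C, hC⟩ : invariantOrders (eta V).ker S) ∈ (⊥ : Clopens _))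

theorem mem_support_eta_sup_one {a : G} {C : invariantOrders (eta V (G := G)).ker S} :
    C ∈ hV.support (eta V a ⊔ 1) ↔ C.1 ∈ PreCone.P a := by
  have hact := PreCone.isLHom_act (hV.mem_rightPreorders C.2)
  rw [mem_support, hact.1, map_one, Aut.sup_apply, Aut.one_apply, PreCone.act_eta,
    PreCone.R_apply_cls, one_mul, Ne, max_eq_right_iff, C.1.cls_le_one]
  exact ⟨fun h => ⟨(C.1.total a).resolve_right h, h⟩, fun h => h.2⟩

theorem support_surjective : Function.Surjective hV.support := by
  refine fun U => clopens_mem_of_supClosed_of_infClosed (F := Set.range hV.support)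
    ?_ ?_ ⟨1, hV.support_one⟩ (fun C => ?_) (fun C D hCD => ?_) U
  · rintro _ ⟨x, rfl⟩ _ ⟨y, rfl⟩
    exact ⟨_, hV.support_mabs_sup_mabs x y⟩
  · rintro _ ⟨x, rfl⟩ _ ⟨y, rfl⟩
    exact ⟨_, hV.support_mabs_inf_mabs x y⟩
  · obtain ⟨a, ha⟩ := C.1.proper'
    exact ⟨_, ⟨eta V a⁻¹ ⊔ 1, rfl⟩, hV.mem_support_eta_sup_one.2
      ⟨C.1.inv_mem_of_notMem ha, by rwa [inv_inv]⟩⟩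
  · obtain ⟨a, ha, haD⟩ := invariantOrders.exists_mem_P_notMem_of_ne hCD
    exact ⟨_, ⟨eta V a ⊔ 1, rfl⟩, hV.mem_support_eta_sup_one.2 ha,
      fun h => haD (hV.mem_support_eta_sup_one.1 h).1⟩

theorem isSupportMap : IsSupportMap hV.support where
  surjective := hV.support_surjective
  disjoint_iff x y := by rw [disjoint_iff, ← support_mabs_inf_mabs, support_eq_bot_iff]

theorem duality : IsStoneSpace (minimalLayer V G) ∧
    IsBooleanSubalgebraOfPolars (principalPolars (Free V G)) ∧
    Nonempty (Clopens (minimalLayer V G) ≃o principalPolars (Free V G)) ∧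
    Nonempty (minimalLayer V G ≃ₜ StoneDual (principalPolars (Free V G))) := by
  rw [hV.minimalLayer_eq]
  obtain ⟨e⟩ := hV.isSupportMap.nonempty_orderIso_principalPolars
  exact ⟨invariantOrders.isStoneSpace, hV.isSupportMap.isBooleanSubalgebraOfPolars, ⟨e⟩,
    ⟨StoneDual.homeomorph.trans (StoneDual.congr e.symm)⟩⟩

theorem exists_homeomorph_invariantOrders :
    ∃ Φ : minimalLayer V G ≃ₜ
        invariantOrders (⊥ : Subgroup (eta V (G := G)).range) (S.map (eta V).rangeRestrict),
      ∀ C, ((Φ C).1 : Set (eta V (G := G)).range) = (eta V).rangeRestrict '' (C.1 : Set G) := by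
  have hker : minimalLayer V G = invariantOrders (eta V (G := G)).rangeRestrict.ker S := by
    rw [MonoidHom.ker_rangeRestrict, hV.minimalLayer_eq]
  refine ⟨(Homeomorph.setCongr hker).trans (invariantOrders.mapHomeomorph
    (eta V).rangeRestrict_surjective (fun _ _ h => eta_monotone V h) fun C hC a ha => ?_),
    fun C => rfl⟩
  exact PreCone.mem_of_one_le_eta (hker.ge hC).prop ha

end InvariantPreordersSuffice

end Action

/-! ### The three varieties -/

section Varieties

open Filter

namespace PreCone

variable {G : Type u} [Group G] [PartialOrder G]

theorem IsPrime.comap {H L : Type*} [Group H] [Lattice H] [Group L] [Lattice L] {f : H →* L}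
    {D : PreCone L} (hD : D.IsPrime) (hf : IsLHom f) {hne : ∃ a, f a ∉ D} :
    (comap f hf.monotone D hne).IsPrime := fun a ha => by
  rw [mem_comap, hf.2, map_one]
  exact hD _ ha

theorem isPrime_oneLE (L : Type*) [Group L] [LinearOrder L] [MulLeftMono L] [Nontrivial L] :
    (oneLE L).IsPrime := fun _ ha => le_inf ha le_rfl

theorem isInvariant_oneLE (L : Type*) [Group L] [LinearOrder L] [MulLeftMono L] [MulRightMono L]
    [Nontrivial L] (S : Subgroup L) : (oneLE L).IsInvariant S := fun a (ha : 1 ≤ a) b _ =>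
  show 1 ≤ b * a * b⁻¹ by rwa [le_mul_inv_iff_mul_le, one_mul, le_mul_iff_one_le_right']

theorem IsInvariant.comap {H : Type*} [Group H] [PartialOrder H] {p : G →* H} {hp : Monotone p}
    {D : PreCone H} {hne : ∃ a, p a ∉ D} {S : Subgroup G} (hD : D.IsInvariant (S.map p)) :
    (comap p hp D hne).IsInvariant S := fun a ha b hb => by
  rw [mem_comap, map_mul, map_mul, map_inv]
  exact hD _ ha _ ⟨b, hb, rfl⟩

variable {C : PreCone G}

theorem IsInvariant.R_le_R (hC : C.IsInvariant ⊤) {a b : G} (h : b * a⁻¹ ∈ C) : C.R a ≤ C.R b := by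
  intro x
  obtain ⟨c, rfl⟩ := C.cls_surjective x
  change C.cls (c * a) ≤ C.cls (c * b)
  rw [cls_le_cls]
  simpa [mul_assoc] using hC _ h c trivial

theorem IsInvariant.R_total (hC : C.IsInvariant ⊤) (a b : G) : C.R a ≤ C.R b ∨ C.R b ≤ C.R a :=
  (C.total (b * a⁻¹)).imp hC.R_le_R fun h => hC.R_le_R (by simpa using h)

theorem IsInvariant.exists_R_eq (hC : C.IsInvariant ⊤) (f : C.H) : ∃ a, C.R a = f := by
  refine Subgroup.mem_sInf.1 f.2 C.R.range ⟨fun _ h => h, ?_, ?_⟩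
  · rintro _ ⟨a, rfl⟩ _ ⟨b, rfl⟩
    rcases hC.R_total a b with h | h
    · exact ⟨b, (sup_eq_right.2 h).symm⟩
    · exact ⟨a, (sup_eq_left.2 h).symm⟩
  · rintro _ ⟨a, rfl⟩ _ ⟨b, rfl⟩
    rcases hC.R_total a b with h | h
    · exact ⟨a, (inf_eq_left.2 h).symm⟩
    · exact ⟨b, (inf_eq_right.2 h).symm⟩

theorem IsInvariant.H_total (hC : C.IsInvariant ⊤) (f g : C.H) : f ≤ g ∨ g ≤ f := by
  obtain ⟨a, ha⟩ := hC.exists_R_eq f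
  obtain ⟨b, hb⟩ := hC.exists_R_eq g
  have h := hC.R_total a b
  rwa [ha, hb] at h

theorem IsInvariant.representableLGroups_H (hC : C.IsInvariant ⊤) : representableLGroups C.H := by
  classical
  let L : LinearOrder C.H :=
    @Lattice.toLinearOrder _ _ _ (Classical.decRel _) (Classical.decRel _) ⟨hC.H_total⟩
  exact ⟨PUnit, fun _ => C.H, fun _ => inferInstance, fun _ => L,
    fun _ => (inferInstance : MulLeftMono C.H), fun _ => (inferInstance : MulRightMono C.H),
    fun _ => MonoidHom.id _, fun _ => ⟨fun _ _ => rfl, fun _ _ => rfl⟩,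
    fun _ => Function.surjective_id, fun x y h => h PUnit.unit⟩

theorem IsInvariant.abelianLGroups_H (hC : C.IsInvariant ⊤)
    (hcomm : (eta abelianLGroups).ker ≤ C.core) : abelianLGroups C.H := by
  intro f g
  obtain ⟨a, ha⟩ := hC.exists_R_eq f
  obtain ⟨b, hb⟩ := hC.exists_R_eq g
  refine Subtype.ext (Aut.ext (C.cls_surjective.forall.2 fun c => ?_))
  rw [Subgroup.coe_mul, Subgroup.coe_mul, ← ha, ← hb, ← map_mul, ← map_mul, R_apply_cls,
    R_apply_cls, cls_eq_cls_iff_mem_core]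
  refine hcomm ?_
  simp only [MonoidHom.mem_ker, map_mul, map_inv]
  rw [free_abelian_mem (eta _ a), mul_inv_cancel]

end PreCone

variable {G : Type u} [Group G] [PartialOrder G]

theorem exists_eval_ne_one {V : LGroupClass.{u}} {t : Term G} (ht : (Free.mk t : Free V G) ≠ 1) :
    ∃ (H : Type u) (_ : Group H) (_ : Lattice H) (_ : MulLeftMono H) (_ : MulRightMono H)
      (_ : V H) (p : G →* H), Monotone p ∧ t.eval p ≠ 1 := by
  by_contra! h
  exact ht (Free.ext fun H _ _ _ _ hV p hp => h H _ _ _ _ hV p hp)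

section Comap

variable {V : LGroupClass.{u}} {H : Type u} [Group H] [Lattice H] [MulLeftMono H] [MulRightMono H]
  {p : G →* H}

theorem ker_eta_le_ker (hV : V H) (hp : Monotone p) : (eta V).ker ≤ p.ker :=
  fun _ ha => congrArg (Free.ev hV p hp) ha

theorem exists_invariantPreorder_eval_ne (hV : V H) (hp : Monotone p) {D : PreCone H}
    (hD : D.IsPrime) {S : Subgroup G} (hS : D.IsInvariant (S.map p)) {t : Term G}
    (ht : D.cls (t.eval p) ≠ D.cls 1) :
    ∃ C ∈ invariantPreorders (eta V).ker S, t.eval C.R (C.cls 1) ≠ C.cls 1 := by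
  have hne : ∃ a, p a ∉ D := by
    by_contra! h
    refine ht ((hD.eval_comp p t).symm.trans (Term.eval_apply_eq_of_forall (fun a => ?_) t))
    rw [Function.comp_apply, PreCone.R_apply_cls, one_mul, D.cls_eq_one]
    exact D.mem_core.2 ⟨h a, by simpa using h a⁻¹⟩
  let C := PreCone.comap p hp D hne
  refine ⟨C, ⟨fun a ha => ?_, hS.comap⟩, fun h => ht ?_⟩
  · have hpa : p a = 1 := ker_eta_le_ker hV hp ha
    rw [C.mem_core, PreCone.mem_comap, PreCone.mem_comap, map_inv, hpa, inv_one, and_self]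
    exact D.one_mem
  · have hequiv := Term.eval_equivariant (C.omegaMap_monotone D p fun _ => PreCone.mem_comap.1)
      (ρ := C.R) (ρ' := D.R ∘ p) (fun a => C.cls_surjective.forall.2 fun b => by simp) t (C.cls 1)
    rw [h, PreCone.omegaMap_cls, map_one, hD.eval_comp] at hequiv
    exact hequiv.symm

end Comap

theorem exists_ultrafilter_eventually_one_lt {H ι : Type*} {L : ι → Type*} [Group H] [Lattice H]
    [∀ i, Group (L i)] [∀ i, LinearOrder (L i)] {f : ∀ i, H →* L i} (hf : ∀ i, IsLHom (f i))
    (hinj : ∀ x y, (∀ i, f i x = f i y) → x = y) {P : Set H} (hP : InfClosed P)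
    (hne : P.Nonempty) (hone : ∀ h ∈ P, ¬ h ≤ 1) :
    ∃ U : Ultrafilter ι, ∀ h ∈ P, ∀ᶠ i in U, 1 < f i h := by
  have : Nonempty P := hne.to_subtype
  let F : Filter ι := ⨅ h : P, 𝓟 {i | 1 < f i h}
  have hF : F.NeBot := by
    refine iInf_neBot_of_directed' (fun h k => ⟨⟨h ⊓ k, hP h.2 k.2⟩, ?_, ?_⟩) fun h => ?_
    · exact principal_mono.2 fun i hi => hi.trans_le ((hf i).monotone inf_le_left)
    · exact principal_mono.2 fun i hi => hi.trans_le ((hf i).monotone inf_le_right)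
    · rw [principal_neBot_iff]
      by_contra! hempty
      refine hone h h.2 (sup_eq_right.1 (hinj _ _ fun i => ?_))
      rw [(hf i).1, map_one, sup_eq_right, ← not_lt]
      exact Set.eq_empty_iff_forall_notMem.1 hempty i
  exact ⟨.of F, fun h hh => Ultrafilter.of_le F (mem_iInf_of_mem ⟨h, hh⟩ (mem_principal_self _))⟩

variable [MulLeftMono G] [MulRightMono G]

theorem invariantPreordersSuffice_allLGroups :
    InvariantPreordersSuffice allLGroups.{u} (⊥ : Subgroup G) where
  subset _ _ := trivial
  exists_le C hC := ⟨C, ⟨PreCone.ker_eta_le_core hC, C.isInvariant_bot⟩, le_rfl⟩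
  exists_eval_ne t ht := by
    obtain ⟨H, _, _, _, _, hV, p, hp, hne⟩ := exists_eval_ne_one ht
    obtain ⟨D, hD, hDt⟩ := PreCone.exists_isPrime_cls_ne hne
    refine exists_invariantPreorder_eval_ne hV hp hD ?_ hDt
    rw [Subgroup.map_bot]
    exact D.isInvariant_bot

theorem invariantPreordersSuffice_abelianLGroups :
    InvariantPreordersSuffice abelianLGroups.{u} (⊤ : Subgroup G) where
  subset C hC := hC.2.abelianLGroups_H hC.1
  exists_le C hC := by
    refine ⟨C, ⟨PreCone.ker_eta_le_core hC, fun a ha b _ => ?_⟩, le_rfl⟩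
    have hcomm : b * a * b⁻¹ * a⁻¹ ∈ (eta abelianLGroups).ker := by
      rw [MonoidHom.mem_ker, map_mul, map_mul, map_mul, free_abelian_mem (eta _ b), map_inv,
        map_inv, mul_inv_cancel_right, mul_inv_cancel]
    simpa using C.mul_mem (PreCone.ker_eta_le_core hC hcomm).1 ha
  exists_eval_ne t ht := by
    obtain ⟨H, _, _, _, _, hV, p, hp, hne⟩ := exists_eval_ne_one ht
    obtain ⟨D, hD, hDt⟩ := PreCone.exists_isPrime_cls_ne hne
    refine exists_invariantPreorder_eval_ne hV hp hD (fun a ha b _ => ?_) hDt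
    rwa [hV b, mul_inv_cancel_right]

theorem PreCone.exists_invariantPreorder_le_of_representableLGroups_H {C : PreCone G}
    (hC : representableLGroups C.H) :
    ∃ D ∈ invariantPreorders (eta representableLGroups).ker ⊤, D ≤ C := by
  obtain ⟨ι, L, _, _, _, _, f, hf, -, hinj⟩ := id hC
  have one_lt {a : G} (ha : a ∉ C) : C.cls 1 < (C.toH a⁻¹).1 (C.cls 1) := by
    rw [← not_le]
    change ¬ C.R a⁻¹ (C.cls 1) ≤ C.cls 1
    rwa [C.R_apply_cls, one_mul, C.cls_le_one, inv_inv]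
  obtain ⟨a₀, ha₀⟩ := C.proper'
  obtain ⟨U, hU⟩ := exists_ultrafilter_eventually_one_lt hf hinj
    (P := {h : C.H | C.cls 1 < h.1 (C.cls 1)})
    (fun h hh k hk => show C.cls 1 < min (h.1 _) (k.1 _) from lt_min hh hk)
    ⟨C.toH a₀⁻¹, one_lt ha₀⟩ fun h hh hle => hh.not_ge (hle (C.cls 1))
  have eventually_lt {a : G} (ha : a ∉ C) : ∀ᶠ i in U, f i (C.toH a) < 1 :=
    (hU (C.toH a⁻¹) (one_lt ha)).mono fun i hi => by rwa [map_inv, map_inv, one_lt_inv'] at hi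
  let D := ultralimit U (fun i => (Submonoid.oneLE (L i)).comap ((f i).comp C.toH))
    (fun a ha => .of_forall fun i => by
      simpa using ((hf i).monotone.comp C.toH_monotone) ha)
    (fun a => .of_forall fun i => by simpa using le_total 1 (f i (C.toH a)))
    ⟨a₀, (eventually_lt ha₀).mono fun i hi => hi.not_ge⟩
  refine ⟨D, ⟨fun a ha => ?_, fun a ha b _ => ?_⟩, fun a ha => ?_⟩
  · have haC : C.toH a = 1 := ker_eta_le_ker hC C.toH_monotone ha
    constructor <;> exact .of_forall fun i => by simp [haC]
  · refine Eventually.mono ha fun i (hi : 1 ≤ f i (C.toH a)) => ?_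
    change 1 ≤ f i (C.toH (b * a * b⁻¹))
    simp only [map_mul, map_inv]
    rwa [le_mul_inv_iff_mul_le, one_mul, le_mul_iff_one_le_right']
  · by_contra haC
    obtain ⟨i, hi, hi'⟩ := (Eventually.and ha (eventually_lt haC)).exists
    exact hi'.not_ge hi

theorem invariantPreordersSuffice_representableLGroups :
    InvariantPreordersSuffice representableLGroups.{u} (⊤ : Subgroup G) where
  subset C hC := hC.2.representableLGroups_H
  exists_le C hC := C.exists_invariantPreorder_le_of_representableLGroups_H hC
  exists_eval_ne t ht := by
    obtain ⟨H, _, _, _, _, hV, p, hp, hne⟩ := exists_eval_ne_one ht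
    obtain ⟨ι, L, _, _, _, _, f, hf, hsurj, hinj⟩ := id hV
    obtain ⟨i, hi⟩ : ∃ i, f i (t.eval p) ≠ 1 := by
      by_contra! h
      exact hne (hinj _ _ fun i => by rw [h i, map_one])
    have : Nontrivial (L i) := ⟨_, _, hi⟩
    let D := PreCone.comap (f i) (hf i).monotone (.oneLE (L i))
      ((hsurj i).exists.1 (PreCone.oneLE (L i)).proper')
    refine exists_invariantPreorder_eval_ne hV hp (D := D)
      ((PreCone.isPrime_oneLE _).comap (hf i)) (PreCone.isInvariant_oneLE _ _).comap fun h => hi ?_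
    obtain ⟨h1, h2⟩ := D.cls_eq_one.1 h
    exact le_antisymm (one_le_inv'.1 (map_inv (f i) _ ▸ h2)) h1

end Varieties

end LGrp

theorem theorem6p9 {G : Type u} [Group G] [PartialOrder G] [MulLeftMono G] [MulRightMono G]
    (V : LGroupClass.{u})
    (hV : V = allLGroups ∨ V = representableLGroups ∨ V = abelianLGroups) :
    IsStoneSpace (minimalLayer V G) ∧
    IsBooleanSubalgebraOfPolars (principalPolars (Free V G)) ∧
    Nonempty (TopologicalSpace.Clopens (minimalLayer V G) ≃o principalPolars (Free V G)) ∧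
    Nonempty (minimalLayer V G ≃ₜ StoneDual (principalPolars (Free V G))) ∧
    (V = allLGroups →
      ∃ Φ : minimalLayer V G ≃ₜ rightOrders (eta V (G := G)).range,
        ∀ C, ((Φ C).1 : Set (eta V (G := G)).range) = (eta V).rangeRestrict '' (C.1 : Set G)) ∧
    (V = representableLGroups ∨ V = abelianLGroups →
      ∃ Φ : minimalLayer V G ≃ₜ orders (eta V (G := G)).range,
        ∀ C, ((Φ C).1 : Set (eta V (G := G)).range) = (eta V).rangeRestrict '' (C.1 : Set G)) := by
  have suffice_bot : V = allLGroups → InvariantPreordersSuffice V (⊥ : Subgroup G) := by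
    rintro rfl
    exact invariantPreordersSuffice_allLGroups
  have suffice_top : V = representableLGroups ∨ V = abelianLGroups →
      InvariantPreordersSuffice V (⊤ : Subgroup G) := by
    rintro (rfl | rfl)
    · exact invariantPreordersSuffice_representableLGroups
    · exact invariantPreordersSuffice_abelianLGroups
  obtain ⟨hstone, hpolars, hclopens, hdual⟩ :=
    hV.elim (fun h => (suffice_bot h).duality) fun h => (suffice_top h).duality
  refine ⟨hstone, hpolars, hclopens, hdual, fun h => ?_, fun h => ?_⟩
  · have hhomeo := (suffice_bot h).exists_homeomorph_invariantOrders
    rwa [Subgroup.map_bot, ← rightOrders_eq] at hhomeo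
  · have hhomeo := (suffice_top h).exists_homeomorph_invariantOrders
    rwa [Subgroup.map_top_of_surjective _ (eta V).rangeRestrict_surjective, ← orders_eq] at hhomeo
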